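/- A partition is a finite nonincreasing (possibly empty) sequence of positive integers; it is called a $3$-core if none of the hook lengths of its Young diagram is a multiple of $3$. For $n\ge 0$ let $B_3(n)$ denote the number of ordered triples $(\lambda_1,\lambda_2,\lambda_3)$ of partitions such that each $\lambda_i$ is a $3$-core and the sum of all the parts of $\lambda_1,\lambda_2,\lambda_3$ equals $n$. **Theorem.** For every integer $n\ge 0$, \[B_3(30n+10)\equiv B_3(30n+28)\equiv 0 \pmod{120}.\] -/

import Mathlib

/-- The hook length of the cell `c = (i, j)` of the Young diagram `μ`: the number of cells to the
right of `c` in row `i` (the arm), plus the number of cells below `c` in column `j` (the leg),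
plus one for `c` itself. It is only used for cells `c ∈ μ`, where no subtraction truncates. -/
def YoungDiagram.hookLength (μ : YoungDiagram) (c : ℕ × ℕ) : ℕ :=
  (μ.rowLen c.1 - (c.2 + 1)) + (μ.colLen c.2 - (c.1 + 1)) + 1

/-- A partition, given by its Young diagram, is a `t`-core if none of its hook lengths is a
multiple of `t`. -/
def YoungDiagram.IsCore (t : ℕ) (μ : YoungDiagram) : Prop :=
  ∀ c ∈ μ, ¬ t ∣ μ.hookLength c

/-- The (ordered) partition triples of `n` with `t`-cores: triples of partitions, each of which is
a `t`-core, such that the sum of all the parts of the three partitions is `n`. The sum of the parts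
of a partition is the number of cells of its Young diagram; the empty partition is allowed. -/
def coreTriples (t n : ℕ) : Set (YoungDiagram × YoungDiagram × YoungDiagram) :=
  {p | p.1.IsCore t ∧ p.2.1.IsCore t ∧ p.2.2.IsCore t ∧
    p.1.card + p.2.1.card + p.2.2.card = n}

theorem YoungDiagram.finite_card_le (n : ℕ) : {μ : YoungDiagram | μ.card ≤ n}.Finite := by
  have hinj : Function.Injective YoungDiagram.cells := fun μ ν h => YoungDiagram.ext h
  refine Set.Finite.of_finite_image (f := YoungDiagram.cells) ?_ hinj.injOn
  refine (Finset.finite_toSet (Finset.range n ×ˢ Finset.range n).powerset).subset ?_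
  rintro _ ⟨μ, hμ, rfl⟩
  simp only [Finset.coe_powerset, Set.mem_preimage, Set.mem_powerset_iff, Finset.coe_subset]
  rintro ⟨i, j⟩ hc
  have hc' : (i, j) ∈ μ := hc
  have hr : μ.rowLen i ≤ μ.card := by
    rw [YoungDiagram.rowLen_eq_card]; exact Finset.card_le_card (Finset.filter_subset _ _)
  have hl : μ.colLen j ≤ μ.card := by
    rw [YoungDiagram.colLen_eq_card]; exact Finset.card_le_card (Finset.filter_subset _ _)
  have h1 := YoungDiagram.mem_iff_lt_rowLen.1 hc'
  have h2 := YoungDiagram.mem_iff_lt_colLen.1 hc'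
  have h3 : μ.card ≤ n := hμ
  simp only [Finset.mem_product, Finset.mem_range]
  omega

/-- There are finitely many such triples, so that counting them with `Set.ncard` is meaningful. -/
theorem finite_coreTriples (t n : ℕ) : (coreTriples t n).Finite := by
  have h := YoungDiagram.finite_card_le n
  refine (h.prod (h.prod h)).subset ?_
  rintro ⟨a, b, c⟩ ⟨-, -, -, hs⟩
  simp only [Set.mem_prod, Set.mem_ofPred_eq] at hs ⊢
  omega

/-- `B t n` is the number of partition triples of `n` with `t`-cores. -/
noncomputable def B (t n : ℕ) : ℕ := (coreTriples t n).ncard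

/-! The heart of the proof is the formula B_3(n) = ∑ χ(e) D² over e D = n + 1, with χ the nontrivial
character modulo 3 (`coe_B_three_eq`). Both n + 1 = 30m + 11 and n + 1 = 30m + 29 are odd, ≡ 2 mod 3
and ≡ ±1 mod 5. As e D ≡ 2 mod 3 gives χ(D) = -χ(e), pairing (e, D) with (D, e) turns the formula
into a sum of D² - e² over the divisors e ≡ 1 mod 3, and each such difference is divisible by 120
(`dvd_sq_sub_sq`).

The formula is reached in three stages. On the abacus, 3-cores of n correspond to pairs (a, b) of
natural numbers with a² - ab + b² + b = n (`YoungDiagram.ncard_isCore_three`). Up to the six units,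
these pairs are the Eisenstein integers of norm 3n + 1, and unique factorization, in the form of a
recurrence at each prime, counts them by ∑ χ(d) over d ∣ 3n + 1 (`ncard_coreSet`). So B_3(n) is a
threefold convolution of this divisor sum.

The convolution is evaluated by elementary identities in the style of Liouville (`liouville`): two
factors give a third of the sum of the divisors of 3k + 2 (`three_mul_sum_divSum_mul`), and the
third factor gives the formula (`sum_quads_cube`). -/

namespace YoungDiagram

/-! ### Beads, gaps and hook lengths. -/

/-- The bead positions of a Young diagram: the shifted row lengths `λᵢ - i - 1`. -/
def beta (μ : YoungDiagram) (i : ℕ) : ℤ := μ.rowLen i - i - 1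

theorem beta_strictAnti (μ : YoungDiagram) : StrictAnti μ.beta := by
  intro i j hij
  have := μ.rowLen_anti i j hij.le
  simp only [beta]
  omega

theorem beta_of_colLen_le (μ : YoungDiagram) {i : ℕ} (hi : μ.colLen 0 ≤ i) :
    μ.beta i = -i - 1 := by
  have h : (i, 0) ∉ μ := fun h => by
    have := mem_iff_lt_colLen.1 h
    omega
  rw [mem_iff_lt_rowLen] at h
  simp only [beta]
  omega

theorem ext_rowLen {μ ν : YoungDiagram} (h : ∀ i, μ.rowLen i = ν.rowLen i) : μ = ν := by
  ext ⟨i, j⟩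
  rw [mem_cells, mem_cells, mem_iff_lt_rowLen, mem_iff_lt_rowLen, h]

/-- A strictly monotone sequence is determined by its range, and no translation is possible because
both bead sequences end in `-i - 1`. Hence bead sets need only be compared up to a shift. -/
theorem beta_eq_of_range_eq {μ ν : YoungDiagram} {c : ℤ}
    (h : ∀ x, x ∈ Set.range μ.beta ↔ x + c ∈ Set.range ν.beta) : c = 0 ∧ μ = ν := by
  have hμ : StrictMono fun i => -μ.beta i - c := fun i j hij => by
    have := μ.beta_strictAnti hij
    simp only
    omega
  have hν : StrictMono fun i => -ν.beta i := fun i j hij => by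
    have := ν.beta_strictAnti hij
    simp only
    omega
  have hr : (Set.range fun i => -μ.beta i - c) = Set.range fun i => -ν.beta i := by
    ext y
    constructor
    · rintro ⟨i, rfl⟩
      obtain ⟨j, hj⟩ := (h _).1 ⟨i, rfl⟩
      exact ⟨j, by simp only; omega⟩
    · rintro ⟨i, rfl⟩
      obtain ⟨j, hj⟩ := (h (ν.beta i - c)).2 ⟨i, by ring⟩
      exact ⟨j, by simp only; omega⟩
  have he := (StrictMono.range_inj hμ hν).1 hr
  have hc : c = 0 := by
    have h1 := congrFun he (max (μ.colLen 0) (ν.colLen 0))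
    simp only [μ.beta_of_colLen_le (le_max_left _ (ν.colLen 0)),
      ν.beta_of_colLen_le (le_max_right (μ.colLen 0) _)] at h1
    omega
  refine ⟨hc, ext_rowLen fun i => ?_⟩
  have h1 := congrFun he i
  simp only [beta] at h1
  omega

/-- The gaps `j - λ'ⱼ` are not bead positions. -/
theorem sub_colLen_notMem_range_beta (μ : YoungDiagram) (j : ℕ) :
    (j : ℤ) - μ.colLen j ∉ Set.range μ.beta := by
  rintro ⟨i, hi⟩
  simp only [beta] at hi
  by_cases h : (i, j) ∈ μ
  · have h1 := mem_iff_lt_colLen.1 h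
    have h2 := mem_iff_lt_rowLen.1 h
    omega
  · have h1 := mt mem_iff_lt_colLen.2 h
    have h2 := mt mem_iff_lt_rowLen.2 h
    omega

/-- Every integer that is not a bead position is a gap. -/
theorem exists_eq_sub_colLen (μ : YoungDiagram) {x : ℤ} (hx : x ∉ Set.range μ.beta) :
    ∃ j : ℕ, x = j - μ.colLen j := by
  classical
  have hex : ∃ i, μ.beta i < x := by
    refine ⟨max (μ.colLen 0) x.natAbs, ?_⟩
    rw [beta_of_colLen_le _ (le_max_left _ _)]
    have := le_max_right (μ.colLen 0) x.natAbs
    omega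
  -- `c` is the number of beads above `x`, so the gap `x` belongs to a column of length `c`, namely
  -- column `x + c`.
  set c := Nat.find hex with hc
  have h1 : μ.beta c < x := Nat.find_spec hex
  have h2 : ∀ i < c, x < μ.beta i := fun i hi =>
    lt_of_le_of_ne (not_lt.1 (Nat.find_min hex hi)) fun h => hx ⟨i, h.symm⟩
  simp only [beta] at h1 h2
  refine ⟨(x + c).toNat, ?_⟩
  have hj : ((x + c).toNat : ℤ) = x + c := Int.toNat_of_nonneg (by omega)
  have h3 : μ.colLen (x + c).toNat = c := by
    apply le_antisymm
    · by_contra! h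
      have := mem_iff_lt_rowLen.1 (mem_iff_lt_colLen.2 h)
      omega
    · rcases Nat.eq_zero_or_pos c with h | h
      · omega
      · have h4 := h2 (c - 1) (by omega)
        have : (c - 1, (x + c).toNat) ∈ μ := by
          rw [mem_iff_lt_rowLen]
          omega
        have := mem_iff_lt_colLen.1 this
        omega
  rw [h3]
  omega

theorem coe_hookLength (μ : YoungDiagram) {i j : ℕ} (h : (i, j) ∈ μ) :
    (μ.hookLength (i, j) : ℤ) = μ.beta i - (j - μ.colLen j) := by
  have h1 := mem_iff_lt_colLen.1 h
  have h2 := mem_iff_lt_rowLen.1 h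
  simp only [hookLength, beta]
  omega

/-- Hook lengths are the differences between a bead and a gap below it. A bead with a gap `t` places
below gives a hook of length `t`; conversely, closure under steps of `t` leaves no gap at distance
`t * k`. -/
theorem isCore_iff {t : ℕ} (ht : 0 < t) (μ : YoungDiagram) :
    μ.IsCore t ↔ ∀ x ∈ Set.range μ.beta, x - t ∈ Set.range μ.beta := by
  constructor
  · rintro h _ ⟨i, rfl⟩
    by_contra hx
    obtain ⟨j, hj⟩ := μ.exists_eq_sub_colLen hx
    have hm : (i, j) ∈ μ := by
      by_contra hm
      have h1 := mt mem_iff_lt_colLen.2 hm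
      have h2 := mt mem_iff_lt_rowLen.2 hm
      simp only [beta] at hj
      omega
    refine h _ hm ?_
    have := μ.coe_hookLength hm
    exact ⟨1, by omega⟩
  · rintro h ⟨i, j⟩ hc ⟨k, hk⟩
    have h1 : ∀ k : ℕ, μ.beta i - t * k ∈ Set.range μ.beta := by
      intro k
      induction k with
      | zero => exact ⟨i, by simp⟩
      | succ k ih =>
        have := h _ ih
        convert this using 1
        push_cast
        ring
    refine μ.sub_colLen_notMem_range_beta j ?_
    have h2 := μ.coe_hookLength hc
    have h3 := h1 k
    rw [hk] at h2
    push_cast at h2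
    rwa [h2, sub_sub_cancel] at h3

/-! ### The diagram with a prescribed 3-abacus. -/

/-- The diagram obtained by putting a new row of length `w` on top of `μ`. -/
def addTopRow (μ : YoungDiagram) (w : ℕ) (hw : μ.rowLen 0 ≤ w) : YoungDiagram where
  cells := (Finset.range w).image (fun j => (0, j)) ∪ μ.cells.image fun c => (c.1 + 1, c.2)
  isLowerSet := by
    rintro ⟨i, j⟩ ⟨i', j'⟩ ⟨h1, h2⟩ h
    simp only [Finset.coe_union, Finset.coe_image, Set.mem_union,
      Set.mem_image, Finset.mem_coe, Finset.mem_range, Prod.mk.injEq, mem_cells, Prod.exists]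
      at h1 h2 h ⊢
    rcases h with ⟨k, hk, rfl, rfl⟩ | ⟨a, b, hab, rfl, rfl⟩
    · exact Or.inl ⟨j', by omega, by omega, rfl⟩
    · rcases Nat.eq_zero_or_pos i' with rfl | hi
      · refine Or.inl ⟨j', ?_, rfl, rfl⟩
        have := mem_iff_lt_rowLen.1 (μ.up_left_mem (Nat.zero_le a) h2 hab)
        omega
      · exact Or.inr ⟨i' - 1, j', μ.up_left_mem (by omega) h2 hab, by omega, rfl⟩

theorem mem_addTopRow_zero {μ : YoungDiagram} {w : ℕ} (hw : μ.rowLen 0 ≤ w) {j : ℕ} :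
    (0, j) ∈ μ.addTopRow w hw ↔ j < w := by
  rw [← mem_cells]
  simp [addTopRow]

theorem mem_addTopRow_succ {μ : YoungDiagram} {w : ℕ} (hw : μ.rowLen 0 ≤ w) {i j : ℕ} :
    (i + 1, j) ∈ μ.addTopRow w hw ↔ (i, j) ∈ μ := by
  rw [← mem_cells]
  simp [addTopRow]

theorem card_addTopRow {μ : YoungDiagram} {w : ℕ} (hw : μ.rowLen 0 ≤ w) :
    (μ.addTopRow w hw).card = w + μ.card := by
  simp only [YoungDiagram.card, addTopRow]
  rw [Finset.card_union_of_disjoint, Finset.card_image_of_injective, Finset.card_image_of_injective,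
    Finset.card_range]
  · rintro ⟨i, j⟩ ⟨i', j'⟩ h
    simpa using h
  · intro i j h
    simpa using h
  · rw [Finset.disjoint_left]
    simp only [Finset.mem_image]
    rintro _ ⟨j, -, rfl⟩ ⟨c, -, h⟩
    simp at h

theorem beta_addTopRow_zero {μ : YoungDiagram} {w : ℕ} (hw : μ.rowLen 0 ≤ w) :
    (μ.addTopRow w hw).beta 0 = w - 1 := by
  have : (μ.addTopRow w hw).rowLen 0 = w :=
    eq_of_forall_lt_iff fun j => by rw [← mem_iff_lt_rowLen, mem_addTopRow_zero]
  simp [beta, this]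

theorem beta_addTopRow_succ {μ : YoungDiagram} {w : ℕ} (hw : μ.rowLen 0 ≤ w) (i : ℕ) :
    (μ.addTopRow w hw).beta (i + 1) = μ.beta i - 1 := by
  have : (μ.addTopRow w hw).rowLen (i + 1) = μ.rowLen i :=
    eq_of_forall_lt_iff fun j => by
      rw [← mem_iff_lt_rowLen, ← mem_iff_lt_rowLen, mem_addTopRow_succ]
  simp only [beta, this]
  push_cast
  ring

theorem mem_range_beta_addTopRow {μ : YoungDiagram} {w : ℕ} (hw : μ.rowLen 0 ≤ w) (x : ℤ) :
    x ∈ Set.range (μ.addTopRow w hw).beta ↔ x = w - 1 ∨ x + 1 ∈ Set.range μ.beta := by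
  constructor
  · rintro ⟨_ | i, rfl⟩
    · exact Or.inl (beta_addTopRow_zero hw)
    · exact Or.inr ⟨i, by rw [beta_addTopRow_succ]; ring⟩
  · rintro (h | ⟨i, hi⟩)
    · exact ⟨0, by rw [beta_addTopRow_zero, h]⟩
    · exact ⟨i + 1, by rw [beta_addTopRow_succ, hi]; ring⟩

/-- The beads of a `3`-abacus that is full on the negative positions, and carries beads at the first
`a` nonnegative positions congruent to `1` and the first `b` ones congruent to `2`. -/
def IsBead (a b : ℕ) (y : ℤ) : Prop :=
  y < 0 ∨ (y % 3 = 1 ∧ y < 3 * a + 1) ∨ (y % 3 = 2 ∧ y < 3 * b + 2)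

/-- Induction on the number of nonnegative beads: removing the largest bead deletes the top row. The
shift by `a + b` accounts for `beta` having as many nonnegative beads as negative gaps. -/
theorem exists_range_beta_eq (n : ℕ) : ∀ a b : ℕ, a + b = n →
    ∃ μ : YoungDiagram, (∀ x, x ∈ Set.range μ.beta ↔ IsBead a b (x + a + b)) ∧
      μ.card + a * b = a * a + b * b + b := by
  induction n with
  | zero =>
    intro a b hab
    obtain ⟨rfl, rfl⟩ : a = 0 ∧ b = 0 := by omega
    refine ⟨⊥, fun x => ?_, by simp⟩
    have hb : ∀ i, (⊥ : YoungDiagram).beta i = -i - 1 := fun i => by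
      have : (i, 0) ∉ (⊥ : YoungDiagram) := notMem_bot _
      rw [mem_iff_lt_rowLen] at this
      simp only [beta]
      omega
    simp only [Set.mem_range, hb, IsBead]
    constructor
    · rintro ⟨i, rfl⟩
      omega
    · intro h
      exact ⟨(-x - 1).toNat, by omega⟩
  | succ n ih =>
    have key : ∀ a b a' b' w : ℕ, a' + b' = n → a + b = n + 1 →
        (∀ y, IsBead a b y ↔ y = w + n ∨ IsBead a' b' y) →
        (∀ y, IsBead a' b' y → y < w + n) →
        w + (a' * a' + b' * b' + b') + a * b = a * a + b * b + b + a' * b' →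
        ∃ μ : YoungDiagram, (∀ x, x ∈ Set.range μ.beta ↔ IsBead a b (x + a + b)) ∧
          μ.card + a * b = a * a + b * b + b := by
      intro a b a' b' w h' h h1 h2 h3
      obtain ⟨μ, hμ, hc⟩ := ih a' b' h'
      have hw : μ.rowLen 0 ≤ w := by
        have h4 := h2 _ ((hμ _).1 ⟨0, rfl⟩)
        simp only [beta] at h4
        omega
      refine ⟨μ.addTopRow w hw, fun x => ?_, by rw [card_addTopRow]; omega⟩
      rw [mem_range_beta_addTopRow, hμ, h1]
      have e1 : x + 1 + a' + b' = x + a + b := by omega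
      rw [e1]
      refine or_congr ?_ Iff.rfl
      omega
    intro a b hab
    -- The largest bead is `3 * (a - 1) + 1` if `b < a` and `3 * (b - 1) + 2` otherwise; subtracting
    -- the number `n` of the other nonnegative beads gives the row length `w`.
    rcases lt_or_ge b a with h | h
    · obtain ⟨a, rfl⟩ : ∃ a', a = a' + 1 := ⟨a - 1, by omega⟩
      obtain ⟨d, rfl⟩ := Nat.exists_eq_add_of_le (Nat.lt_succ_iff.1 h)
      refine key _ _ (b + d) b (b + 2 * d + 1) (by omega) hab ?_ ?_ (by ring)
      · intro y
        simp only [IsBead]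
        omega
      · intro y
        simp only [IsBead]
        omega
    · obtain ⟨d, rfl⟩ := Nat.exists_eq_add_of_le h
      obtain ⟨m, hm⟩ : ∃ m, a + d = m + 1 := ⟨a + d - 1, by omega⟩
      rw [hm] at hab h ⊢
      refine key _ _ a m (a + 2 * d) (by omega) hab ?_ ?_ ?_
      · intro y
        simp only [IsBead]
        omega
      · intro y
        simp only [IsBead]
        omega
      · have h5 : a + 2 * d + a = 2 * (m + 1) := by omega
        nlinarith

end YoungDiagram

/-! ### Parametrization of the 3-cores. -/

namespace YoungDiagram

/-- The shift by `μ.colLen 0` moves the lowest gap to 0. Closure under steps of 3 then empties the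
nonnegative part of runner 0 and makes the beads on runners 1 and 2 initial segments. -/
theorem IsCore.exists_isBead {μ : YoungDiagram} (h : μ.IsCore 3) :
    ∃ a b : ℕ, ∀ x, x ∈ Set.range μ.beta ↔ IsBead a b (x + μ.colLen 0) := by
  classical
  have h3 := (isCore_iff (by norm_num) μ).1 h
  push_cast at h3
  have hdown : ∀ (k : ℕ) (x : ℤ), x + 3 * k ∈ Set.range μ.beta → x ∈ Set.range μ.beta := by
    intro k
    induction k with
    | zero => intro x hx; simpa using hx
    | succ k ih =>
      intro x hx
      refine ih x ?_
      have := h3 _ hx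
      push_cast at this
      convert this using 1
      ring
  have hneg : ∀ x : ℤ, x + μ.colLen 0 < 0 → x ∈ Set.range μ.beta := by
    intro x hx
    refine ⟨(-x - 1).toNat, ?_⟩
    rw [beta_of_colLen_le] <;> omega
  have hzero : -(μ.colLen 0 : ℤ) ∉ Set.range μ.beta := by
    simpa using μ.sub_colLen_notMem_range_beta 0
  have hchain : ∀ r : ℤ, ∃ a : ℕ, ∀ k : ℕ, r + 3 * k ∈ Set.range μ.beta ↔ k < a := by
    intro r
    have hex : ∃ k : ℕ, r + 3 * k ∉ Set.range μ.beta := by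
      refine ⟨(μ.beta 0 + 1 - r).toNat, ?_⟩
      rintro ⟨i, hi⟩
      have := μ.beta_strictAnti.antitone (Nat.zero_le i)
      omega
    refine ⟨Nat.find hex, fun k => ⟨fun hk => ?_, fun hk => not_not.1 (Nat.find_min hex hk)⟩⟩
    by_contra! hle
    refine Nat.find_spec hex (hdown (k - Nat.find hex) _ ?_)
    convert hk using 1
    push_cast [hle]
    ring
  obtain ⟨a, ha⟩ := hchain (1 - μ.colLen 0)
  obtain ⟨b, hb⟩ := hchain (2 - μ.colLen 0)
  refine ⟨a, b, fun x => ?_⟩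
  by_cases hx : x + μ.colLen 0 < 0
  · exact iff_of_true (hneg x hx) (Or.inl hx)
  obtain ⟨k, hk⟩ : ∃ k : ℕ, (x + μ.colLen 0) / 3 = k :=
    ⟨((x + μ.colLen 0) / 3).toNat, by omega⟩
  have hr : (x + μ.colLen 0) % 3 = 0 ∨ (x + μ.colLen 0) % 3 = 1 ∨ (x + μ.colLen 0) % 3 = 2 := by
    omega
  rcases hr with hr | hr | hr
  · refine iff_of_false (fun hm => hzero (hdown k _ ?_)) (by simp only [IsBead]; omega)
    convert hm using 1
    omega
  · have e : x = 1 - μ.colLen 0 + 3 * k := by omega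
    rw [e, ha]
    simp only [IsBead]
    omega
  · have e : x = 2 - μ.colLen 0 + 3 * k := by omega
    rw [e, hb]
    simp only [IsBead]
    omega

/-- The `3`-cores of size `n` are parametrized by the pairs of natural numbers `(a, b)` with
`a ^ 2 - a * b + b ^ 2 + b = n`. -/
theorem ncard_isCore_three (n : ℕ) :
    {μ : YoungDiagram | μ.IsCore 3 ∧ μ.card = n}.ncard =
      {p : ℕ × ℕ | p.1 * p.1 + p.2 * p.2 + p.2 = n + p.1 * p.2}.ncard := by
  have hex : ∀ p : ℕ × ℕ, ∃ μ : YoungDiagram,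
      (∀ x, x ∈ Set.range μ.beta ↔ IsBead p.1 p.2 (x + p.1 + p.2)) ∧
        μ.card + p.1 * p.2 = p.1 * p.1 + p.2 * p.2 + p.2 := fun p =>
    exists_range_beta_eq _ p.1 p.2 rfl
  choose f hf hc using hex
  have hcore : ∀ p, (f p).IsCore 3 := fun p => by
    rw [isCore_iff (by norm_num)]
    intro x hx
    rw [hf] at hx ⊢
    simp only [IsBead] at hx ⊢
    omega
  have hinj : Function.Injective f := by
    rintro ⟨a, b⟩ ⟨a', b'⟩ h
    have h1 : ∀ x, IsBead a b (x + a + b) ↔ IsBead a' b' (x + a' + b') := fun x => by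
      rw [← hf (a, b), ← hf (a', b'), h]
    simp only [IsBead] at h1
    -- Position 0 is the lowest gap of each abacus, so the shifts agree; below, `3 * a + 1` is the
    -- lowest gap on runner 1.
    have e : a + b = a' + b' := by
      have h2 := h1 (-a - b)
      have h3 := h1 (-a' - b')
      omega
    have e1 : a = a' := by
      have h2 := h1 (3 * a + 1 - a - b)
      have h3 := h1 (3 * a' + 1 - a - b)
      omega
    rw [e1] at e ⊢
    rw [Nat.add_left_cancel e]
  rw [← Set.ncard_image_of_injective _ hinj]
  congr 1
  ext μ
  simp only [Set.mem_ofPred_eq, Set.mem_image]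
  constructor
  · rintro ⟨h, rfl⟩
    obtain ⟨a, b, hab⟩ := h.exists_isBead
    have h1 : ∀ x, x ∈ Set.range μ.beta ↔
        x + (μ.colLen 0 - a - b) ∈ Set.range (f (a, b)).beta := fun x => by
      rw [hab, hf]
      have : x + (μ.colLen 0 - a - b) + a + b = x + μ.colLen 0 := by ring
      simp only [this]
    obtain ⟨-, rfl⟩ := beta_eq_of_range_eq h1
    exact ⟨(a, b), (hc _).symm, rfl⟩
  · rintro ⟨p, hp, rfl⟩
    have := hc p
    exact ⟨hcore p, by omega⟩

end YoungDiagram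

/-! ### The character modulo 3 and its divisor sum. -/

/-- The nontrivial Dirichlet character modulo `3`. -/
def chi (n : ℕ) : ℤ := if n % 3 = 1 then 1 else if n % 3 = 2 then -1 else 0

theorem chi_mul (m n : ℕ) : chi (m * n) = chi m * chi n := by
  have h : (m * n) % 3 = (m % 3) * (n % 3) % 3 := Nat.mul_mod m n 3
  have hm : m % 3 = 0 ∨ m % 3 = 1 ∨ m % 3 = 2 := by omega
  have hn : n % 3 = 0 ∨ n % 3 = 1 ∨ n % 3 = 2 := by omega
  rcases hm with hm | hm | hm <;> rcases hn with hn | hn | hn <;>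
    simp [chi, h, hm, hn]

theorem chi_one : chi 1 = 1 := rfl

theorem chi_pow (m k : ℕ) : chi (m ^ k) = chi m ^ k := by
  induction k with
  | zero => simp [chi_one]
  | succ k ih => rw [pow_succ, chi_mul, ih, pow_succ]

/-- The sum of `chi` over the divisors of `m`. -/
def divSum (m : ℕ) : ℤ := ∑ d ∈ m.divisors, chi d

theorem divSum_mul {m n : ℕ} (h : m.Coprime n) : divSum (m * n) = divSum m * divSum n := by
  rw [divSum, divSum, divSum, Nat.divisors_mul, Finset.sum_mul_sum, ← Finset.sum_product',
    Finset.mul_def, Finset.sum_image h.mul_injOn_divisors]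
  simp only [chi_mul]

theorem divSum_prime_pow {p : ℕ} (hp : p.Prime) (a : ℕ) :
    divSum (p ^ a) = ∑ i ∈ Finset.range (a + 1), chi p ^ i := by
  rw [divSum, Nat.sum_divisors_prime_pow hp]
  simp only [chi_pow]

/-! ### Counting Eisenstein integers of given norm. -/

/-- The Eisenstein integers `x + y ω` of norm `m`. -/
def eisSet (m : ℤ) : Set (ℤ × ℤ) := {v | v.1 ^ 2 - v.1 * v.2 + v.2 ^ 2 = m}

theorem mem_eisSet {m x y : ℤ} : (x, y) ∈ eisSet m ↔ x ^ 2 - x * y + y ^ 2 = m := Iff.rfl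

theorem finite_eisSet (m : ℤ) : (eisSet m).Finite := by
  refine ((Set.finite_Icc (-(2 * m)) (2 * m)).prod (Set.finite_Icc (-(2 * m)) (2 * m))).subset ?_
  rintro ⟨x, y⟩ h
  rw [mem_eisSet] at h
  simp only [Set.mem_prod, Set.mem_Icc]
  have h1 : 3 * x ^ 2 ≤ 4 * m := by nlinarith [sq_nonneg (x - 2 * y)]
  have h2 : 3 * y ^ 2 ≤ 4 * m := by nlinarith [sq_nonneg (y - 2 * x)]
  refine ⟨⟨?_, ?_⟩, ?_, ?_⟩
  · nlinarith [Int.le_self_sq x, Int.le_self_sq (-x)]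
  · nlinarith [Int.le_self_sq x, Int.le_self_sq (-x)]
  · nlinarith [Int.le_self_sq y, Int.le_self_sq (-y)]
  · nlinarith [Int.le_self_sq y, Int.le_self_sq (-y)]

/-- Multiplication of Eisenstein integers by `s + t ω`. -/
def eisMul (s t : ℤ) (v : ℤ × ℤ) : ℤ × ℤ := (s * v.1 - t * v.2, s * v.2 + t * v.1 - t * v.2)

theorem eisMul_mem {s t m k : ℤ} (h : s ^ 2 - s * t + t ^ 2 = m) {v : ℤ × ℤ}
    (hv : v ∈ eisSet k) : eisMul s t v ∈ eisSet (m * k) := by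
  obtain ⟨x, y⟩ := v
  rw [mem_eisSet] at hv
  rw [eisMul, mem_eisSet, ← h, ← hv]
  ring

/-- The conjugate of `s + t ω` is `(s - t) - t ω`, because `ω` has conjugate `-1 - ω`. -/
theorem eisMul_conj (s t : ℤ) (v : ℤ × ℤ) : eisMul (s - t) (-t) (eisMul s t v) =
    ((s ^ 2 - s * t + t ^ 2) * v.1, (s ^ 2 - s * t + t ^ 2) * v.2) := by
  simp only [eisMul, Prod.mk.injEq]
  constructor <;> ring

theorem eisMul_injective {s t : ℤ} (h : s ^ 2 - s * t + t ^ 2 ≠ 0) :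
    Function.Injective (eisMul s t) := by
  rintro ⟨x, y⟩ ⟨x', y'⟩ h1
  have h2 := congrArg (eisMul (s - t) (-t)) h1
  rw [eisMul_conj, eisMul_conj] at h2
  simp only [Prod.mk.injEq, mul_eq_mul_left_iff, h, or_false] at h2
  exact Prod.ext h2.1 h2.2

theorem ncard_image_eisMul {s t : ℤ} (h : s ^ 2 - s * t + t ^ 2 ≠ 0) (k : ℤ) :
    (eisMul s t '' eisSet k).ncard = (eisSet k).ncard :=
  Set.ncard_image_of_injective _ (eisMul_injective h)

/-- Divisibility by an Eisenstein prime of prime norm `p` is detected by one coordinate. -/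
theorem mem_image_eisMul_iff {p : ℕ} (hp : p.Prime) {s t : ℤ} (h : s ^ 2 - s * t + t ^ 2 = p)
    {k x y : ℤ} (hv : (x, y) ∈ eisSet (p * k)) :
    (x, y) ∈ eisMul s t '' eisSet k ↔ (p : ℤ) ∣ s * y - t * x := by
  have hp' : Prime (p : ℤ) := Nat.prime_iff_prime_int.1 hp
  rw [mem_eisSet] at hv
  constructor
  · rintro ⟨⟨u, v⟩, -, huv⟩
    simp only [eisMul, Prod.mk.injEq] at huv
    refine ⟨v, ?_⟩
    rw [← huv.1, ← huv.2, ← h]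
    ring
  · rintro ⟨v, hB⟩
    -- This and `s * y - t * x` are the coordinates of the conjugate of `s + t ω` times `x + y ω`,
    -- whose norm is `p * (p * k)`; if `p` divides one coordinate, it divides the other.
    have hA : (p : ℤ) ∣ (s - t) * x + t * y := by
      refine hp'.dvd_of_dvd_pow (n := 2) ⟨p * k - p * v ^ 2 + ((s - t) * x + t * y) * v, ?_⟩
      have e : ((s - t) * x + t * y) ^ 2 - ((s - t) * x + t * y) * (s * y - t * x) +
          (s * y - t * x) ^ 2 = p * (p * k) := by
        rw [← hv]
        nth_rewrite 1 [← h]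
        ring
      rw [hB] at e
      linear_combination e
    obtain ⟨u, hu⟩ := hA
    have hp0 : (p : ℤ) ≠ 0 := hp'.ne_zero
    have hx : s * u - t * v = x := by
      apply mul_left_cancel₀ hp0
      linear_combination (-s) * hu + t * hB + x * h
    have hy : s * v + t * u - t * v = y := by
      apply mul_left_cancel₀ hp0
      linear_combination (t - s) * hB - t * hu + y * h
    refine ⟨(u, v), ?_, by simp only [eisMul, hx, hy]⟩
    rw [mem_eisSet]
    apply mul_left_cancel₀ hp0
    rw [← hv, ← hx, ← hy, ← h]
    ring

theorem norm_conj {s t m : ℤ} (h : s ^ 2 - s * t + t ^ 2 = m) :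
    (s - t) ^ 2 - (s - t) * (-t) + (-t) ^ 2 = m := by
  rw [← h]; ring

theorem eisSet_prime_mul {p : ℕ} (hp : p.Prime) {s t : ℤ} (h : s ^ 2 - s * t + t ^ 2 = p)
    (k : ℤ) : eisSet (p * k) =
      eisMul s t '' eisSet k ∪ eisMul (s - t) (-t) '' eisSet k := by
  have hp' : Prime (p : ℤ) := Nat.prime_iff_prime_int.1 hp
  apply Set.Subset.antisymm
  · rintro ⟨x, y⟩ hv
    rw [Set.mem_union, mem_image_eisMul_iff hp h hv, mem_image_eisMul_iff hp (norm_conj h) hv]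
    -- The product of the two linear forms is `p * (y ^ 2 - t ^ 2 * k)`, so one of the conjugate
    -- primes divides.
    apply hp'.dvd_or_dvd
    rw [mem_eisSet] at hv
    refine ⟨y ^ 2 - t ^ 2 * k, ?_⟩
    linear_combination y ^ 2 * h - t ^ 2 * hv
  · rintro _ (⟨v, hv, rfl⟩ | ⟨v, hv, rfl⟩)
    · exact eisMul_mem h hv
    · exact eisMul_mem (norm_conj h) hv

/-- The sum and difference of the two divisibility criteria give `p ∣ y * (2 * s - t)` and `p ∣ t *
(2 * x - y)`. Since `4 * p = (2 * s - t) ^ 2 + 3 * t ^ 2`, neither `t` nor `2 * s - t` is divisible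
by `p`. -/
theorem image_inter_image_eisMul {p : ℕ} (hp : p.Prime) (h2 : p ≠ 2) (h3 : p ≠ 3) {s t : ℤ}
    (h : s ^ 2 - s * t + t ^ 2 = p) (k : ℤ) :
    eisMul s t '' eisSet k ∩ eisMul (s - t) (-t) '' eisSet k =
      {v | v ∈ eisSet (p * k) ∧ (p : ℤ) ∣ v.1 ∧ (p : ℤ) ∣ v.2} := by
  have hp' : Prime (p : ℤ) := Nat.prime_iff_prime_int.1 hp
  ext ⟨x, y⟩
  rw [Set.mem_inter_iff, Set.mem_ofPred_eq]
  constructor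
  · rintro ⟨h4, h5⟩
    have hv : (x, y) ∈ eisSet (p * k) := by
      rw [eisSet_prime_mul hp h]
      exact Or.inl h4
    rw [mem_image_eisMul_iff hp h hv] at h4
    rw [mem_image_eisMul_iff hp (norm_conj h) hv] at h5
    have hd2 : ¬ (p : ℤ) ∣ 2 := fun hd => h2 <| by
      have := (Nat.prime_dvd_prime_iff_eq hp Nat.prime_two).1 (by exact_mod_cast hd)
      exact this
    have hd3 : ¬ (p : ℤ) ∣ 3 := fun hd => h3 <| by
      have := (Nat.prime_dvd_prime_iff_eq hp Nat.prime_three).1 (by exact_mod_cast hd)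
      exact this
    have ht : ¬ (p : ℤ) ∣ t := by
      intro ht
      have hs : (p : ℤ) ∣ s := by
        refine hp'.dvd_of_dvd_pow (n := 2) ?_
        have : s ^ 2 = p + t * (s - t) := by linear_combination h
        rw [this]
        exact dvd_add dvd_rfl (ht.mul_right _)
      obtain ⟨s', rfl⟩ := hs
      obtain ⟨t', rfl⟩ := ht
      refine hp'.not_isUnit (isUnit_of_dvd_one ⟨s' ^ 2 - s' * t' + t' ^ 2, ?_⟩)
      apply mul_left_cancel₀ hp'.ne_zero
      linear_combination -h
    have h6 : (p : ℤ) ∣ t * (2 * x - y) := by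
      have e : t * (2 * x - y) = (s - t) * y - -t * x - (s * y - t * x) := by ring
      rw [e]
      exact dvd_sub h5 h4
    have h7 : (p : ℤ) ∣ y * (2 * s - t) := by
      have e : y * (2 * s - t) = (s - t) * y - -t * x + (s * y - t * x) := by ring
      rw [e]
      exact dvd_add h5 h4
    have h8 : ¬ (p : ℤ) ∣ 2 * s - t := by
      intro hd
      have : (p : ℤ) ∣ 3 * t ^ 2 := by
        have e : 3 * t ^ 2 = p * 4 - (2 * s - t) * (2 * s - t) := by linear_combination 4 * h
        rw [e]
        exact dvd_sub (dvd_mul_right _ _) (hd.mul_right _)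
      rcases hp'.dvd_or_dvd this with h9 | h9
      · exact hd3 h9
      · exact ht (hp'.dvd_of_dvd_pow h9)
    have hy := (hp'.dvd_or_dvd h7).resolve_right h8
    have hx2 : (p : ℤ) ∣ 2 * x := by
      have := dvd_add ((hp'.dvd_or_dvd h6).resolve_left ht) hy
      simpa using this
    exact ⟨hv, (hp'.dvd_or_dvd hx2).resolve_left hd2, hy⟩
  · rintro ⟨hv, hx, hy⟩
    rw [mem_image_eisMul_iff hp h hv, mem_image_eisMul_iff hp (norm_conj h) hv]
    exact ⟨dvd_sub (hy.mul_left _) (hx.mul_left _), dvd_sub (hy.mul_left _) (hx.mul_left _)⟩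

theorem ncard_eisSet_dvd {p : ℕ} (hp : p.Prime) (j : ℤ) :
    {v | v ∈ eisSet (p * (p * j)) ∧ (p : ℤ) ∣ v.1 ∧ (p : ℤ) ∣ v.2}.ncard = (eisSet j).ncard := by
  have hp0 : (p : ℤ) ≠ 0 := by exact_mod_cast hp.ne_zero
  have hinj : Function.Injective fun v : ℤ × ℤ => ((p : ℤ) * v.1, (p : ℤ) * v.2) := by
    rintro ⟨x, y⟩ ⟨x', y'⟩ h
    simp only [Prod.mk.injEq, mul_eq_mul_left_iff, hp0, or_false] at h
    exact Prod.ext h.1 h.2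
  rw [← Set.ncard_image_of_injective (eisSet j) hinj]
  congr 1
  ext ⟨x, y⟩
  simp only [Set.mem_ofPred_eq, Set.mem_image, mem_eisSet, Prod.exists, Prod.mk.injEq]
  constructor
  · rintro ⟨h, ⟨u, rfl⟩, ⟨v, rfl⟩⟩
    refine ⟨u, v, ?_, rfl, rfl⟩
    apply mul_left_cancel₀ hp0
    apply mul_left_cancel₀ hp0
    linear_combination h
  · rintro ⟨u, v, h, rfl, rfl⟩
    refine ⟨?_, dvd_mul_right _ _, dvd_mul_right _ _⟩
    linear_combination (p : ℤ) * p * h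

theorem eisSet_dvd_eq_empty {p : ℕ} (hp : p.Prime) {k : ℤ} (hk : ¬ (p : ℤ) ∣ k) :
    {v | v ∈ eisSet (p * k) ∧ (p : ℤ) ∣ v.1 ∧ (p : ℤ) ∣ v.2} = ∅ := by
  have hp0 : (p : ℤ) ≠ 0 := by exact_mod_cast hp.ne_zero
  rw [Set.eq_empty_iff_forall_notMem]
  rintro ⟨x, y⟩ ⟨h, ⟨u, hu⟩, ⟨v, hv⟩⟩
  simp only at hu hv
  subst hu hv
  rw [mem_eisSet] at h
  refine hk ⟨u ^ 2 - u * v + v ^ 2, ?_⟩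
  apply mul_left_cancel₀ hp0
  linear_combination -h

/-- Primes congruent to `2` modulo `3` are inert in the Eisenstein integers. -/
theorem dvd_of_dvd_norm {p : ℕ} (hp : p.Prime) (h2 : p % 3 = 2) {x y : ℤ}
    (h : (p : ℤ) ∣ x ^ 2 - x * y + y ^ 2) : (p : ℤ) ∣ x ∧ (p : ℤ) ∣ y := by
  have : Fact p.Prime := ⟨hp⟩
  obtain ⟨k, hk⟩ : ∃ k, p = 3 * k + 2 := ⟨p / 3, by omega⟩
  -- Cubing is injective modulo `p`, as 3 is prime to `p - 1`; the exponent `3 * (2 * k + 1)` is `2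
  -- * (p - 1) + 1`. A zero norm times `x + y` reads `x ^ 3 = (-y) ^ 3`.
  have hcube : ∀ u : ZMod p, (u ^ 3) ^ (2 * k + 1) = u := fun u => by
    have hu : u ^ (3 * k + 2) = u := (congrArg (u ^ ·) hk.symm).trans (ZMod.pow_card u)
    calc (u ^ 3) ^ (2 * k + 1) = u ^ (3 * k + 2) * u ^ (3 * k + 1) := by ring
      _ = u * u ^ (3 * k + 1) := by rw [hu]
      _ = u ^ (3 * k + 2) := by ring
      _ = u := hu
  have h3 : ((x : ZMod p)) ^ 2 - x * y + (y : ZMod p) ^ 2 = 0 := by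
    have := (ZMod.intCast_zmod_eq_zero_iff_dvd _ p).2 h
    push_cast at this
    exact this
  have hxy : (x : ZMod p) = -y := by
    rw [← hcube x, ← hcube (-y)]
    congr 1
    linear_combination (x + y : ZMod p) * h3
  have h30 : (3 : ZMod p) ≠ 0 := by
    intro h0
    have h4 : ((3 : ℕ) : ZMod p) = 0 := by exact_mod_cast h0
    rw [ZMod.natCast_eq_zero_iff] at h4
    have := (Nat.prime_dvd_prime_iff_eq hp Nat.prime_three).1 h4
    omega
  have hy : (y : ZMod p) = 0 := by
    rw [hxy] at h3
    have h4 : (3 : ZMod p) * y ^ 2 = 0 := by linear_combination h3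
    exact pow_eq_zero_iff (two_ne_zero) |>.1 ((mul_eq_zero.1 h4).resolve_left h30)
  have hx : (x : ZMod p) = 0 := by rw [hxy, hy, neg_zero]
  exact ⟨(ZMod.intCast_zmod_eq_zero_iff_dvd _ p).1 hx, (ZMod.intCast_zmod_eq_zero_iff_dvd _ p).1 hy⟩

/-- Thue's argument: with `z` a primitive cube root of unity modulo `p`, the pigeonhole principle
gives small `x ≡ -z y`, not both zero. Their norm is a multiple of `p` below `3 * p`, and `2 * p` is
excluded because 2 is inert. -/
theorem exists_norm_eq_prime {p : ℕ} (hp : p.Prime) (h1 : p % 3 = 1) :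
    ∃ s t : ℤ, s ^ 2 - s * t + t ^ 2 = p := by
  have : Fact p.Prime := ⟨hp⟩
  have hp' : Prime (p : ℤ) := Nat.prime_iff_prime_int.1 hp
  obtain ⟨z, hz⟩ : ∃ z : ZMod p, z ^ 2 + z + 1 = 0 := by
    have : Fact (Nat.Prime 3) := ⟨Nat.prime_three⟩
    obtain ⟨x, hx⟩ := exists_prime_orderOf_dvd_card (G := (ZMod p)ˣ) 3 (by
      rw [ZMod.card_units]
      omega)
    refine ⟨x, ?_⟩
    have hx3 : (x : ZMod p) ^ 3 = 1 := by
      have := pow_orderOf_eq_one x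
      rw [hx] at this
      rw [← Units.val_pow_eq_pow_val, this, Units.val_one]
    have hx1 : (x : ZMod p) - 1 ≠ 0 := by
      intro h
      have : x = 1 := Units.ext (by rw [sub_eq_zero.1 h, Units.val_one])
      rw [this, orderOf_one] at hx
      omega
    apply mul_left_cancel₀ hx1
    linear_combination hx3
  set q := Nat.sqrt p with hq
  have hq1 : q * q < p := by
    refine lt_of_le_of_ne (Nat.sqrt_le p) fun h => ?_
    have hu := hp'.irreducible.not_isSquare
    exact hu ⟨q, by exact_mod_cast h.symm⟩
  have hq2 : p < (q + 1) * (q + 1) := Nat.lt_succ_sqrt p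
  obtain ⟨⟨a, b⟩, ⟨c, d⟩, hne, heq⟩ := Fintype.exists_ne_map_eq_of_card_lt
    (fun v : Fin (q + 1) × Fin (q + 1) => ((v.1 : ℕ) : ZMod p) + z * ((v.2 : ℕ) : ZMod p))
    (by simpa [ZMod.card] using hq2)
  simp only at heq
  obtain ⟨x, hx⟩ : ∃ x : ℤ, x = (a : ℕ) - (c : ℕ) := ⟨_, rfl⟩
  obtain ⟨y, hy⟩ : ∃ y : ℤ, y = (b : ℕ) - (d : ℕ) := ⟨_, rfl⟩
  have hxy : x ≠ 0 ∨ y ≠ 0 := by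
    by_contra! h
    exact hne (Prod.ext (Fin.ext (by simp only; omega)) (Fin.ext (by simp only; omega)))
  have hxb : |x| ≤ q := by rw [abs_le]; omega
  have hyb : |y| ≤ q := by rw [abs_le]; omega
  have hx2 : x ^ 2 ≤ q ^ 2 := sq_le_sq.2 (by simpa using hxb)
  have hy2 : y ^ 2 ≤ q ^ 2 := sq_le_sq.2 (by simpa using hyb)
  have hdvd : (p : ℤ) ∣ x ^ 2 - x * y + y ^ 2 := by
    rw [← ZMod.intCast_zmod_eq_zero_iff_dvd]
    have e : (x : ZMod p) = - z * y := by
      rw [hx, hy]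
      push_cast
      linear_combination heq
    push_cast
    rw [e]
    linear_combination (y : ZMod p) ^ 2 * hz
  obtain ⟨k, hk⟩ := hdvd
  have hppos : (0 : ℤ) < p := by exact_mod_cast hp.pos
  have hqz : (q : ℤ) * q < p := by exact_mod_cast hq1
  have hlt : x ^ 2 - x * y + y ^ 2 < 3 * p := by nlinarith [sq_nonneg (x + y)]
  have hgt : 0 < x ^ 2 - x * y + y ^ 2 := by
    rcases hxy with h | h
    · nlinarith [sq_nonneg (x - 2 * y), sq_pos_of_ne_zero h]
    · nlinarith [sq_nonneg (y - 2 * x), sq_pos_of_ne_zero h]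
  have hk0 : 0 < k := by
    by_contra! h
    nlinarith
  have hk3 : k < 3 := by
    by_contra! h
    nlinarith
  have hk2 : k ≠ 2 := by
    rintro rfl
    have hex := dvd_of_dvd_norm Nat.prime_two rfl (x := x) (y := y) ⟨p, by rw [hk]; ring⟩
    obtain ⟨⟨u, rfl⟩, ⟨v, rfl⟩⟩ := hex
    have h2 : (p : ℤ) = 2 * (u ^ 2 - u * v + v ^ 2) := by
      push_cast at hk
      linarith
    have h2' : 2 ∣ p := by
      have : (2 : ℤ) ∣ p := ⟨_, h2⟩
      exact_mod_cast this
    have := (Nat.prime_dvd_prime_iff_eq Nat.prime_two hp).1 h2'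
    omega
  obtain rfl : k = 1 := by omega
  exact ⟨x, y, by rw [hk, mul_one]⟩

theorem eisSet_prime_mul_of_inert {p : ℕ} (hp : p.Prime) (h2 : p % 3 = 2) (k : ℤ) :
    eisSet (p * k) = {v | v ∈ eisSet (p * k) ∧ (p : ℤ) ∣ v.1 ∧ (p : ℤ) ∣ v.2} := by
  ext ⟨x, y⟩
  exact ⟨fun h => ⟨h, dvd_of_dvd_norm hp h2 ⟨k, h⟩⟩, fun h => h.1⟩

/-- The number of Eisenstein integers of norm `m`. -/
noncomputable def eisCount (m : ℕ) : ℤ := (eisSet m).ncard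

/-- Writing r for `eisCount`, this is r(pk) + χ(p) r(k/p) = (1 + χ(p)) r(k), with r(k/p) = 0 if p
does not divide k. For split `p` it is inclusion–exclusion over the two conjugate primes; for inert
`p` both sides vanish. -/
theorem eisCount_prime_mul {p : ℕ} (hp : p.Prime) (h3 : p ≠ 3) {k : ℕ} :
    eisCount (p * k) +
      chi p * ({v | v ∈ eisSet (p * k) ∧ (p : ℤ) ∣ v.1 ∧ (p : ℤ) ∣ v.2}.ncard : ℤ) =
      (1 + chi p) * eisCount k := by
  have hr : p % 3 = 1 ∨ p % 3 = 2 := by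
    have : ¬ 3 ∣ p := fun h => h3 ((Nat.prime_dvd_prime_iff_eq Nat.prime_three hp).1 h).symm
    omega
  simp only [eisCount, Nat.cast_mul]
  rcases hr with hr | hr
  · obtain ⟨s, t, h⟩ := exists_norm_eq_prime hp hr
    have h0 : (p : ℤ) ≠ 0 := by exact_mod_cast hp.ne_zero
    have hu := Set.ncard_union_add_ncard_inter (eisMul s t '' eisSet k)
      (eisMul (s - t) (-t) '' eisSet k) ((finite_eisSet _).image _) ((finite_eisSet _).image _)
    rw [← eisSet_prime_mul hp h, image_inter_image_eisMul hp (by omega) h3 h,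
      ncard_image_eisMul (h.trans_ne h0), ncard_image_eisMul ((norm_conj h).trans_ne h0)] at hu
    have hc : chi p = 1 := by simp [chi, hr]
    rw [hc]
    push_cast [← @Nat.cast_inj ℤ] at hu
    linarith
  · have hc : chi p = -1 := by simp [chi, hr]
    rw [← eisSet_prime_mul_of_inert hp hr, hc]
    ring

/-- The recurrence in the exponent has order two, so the induction carries two consecutive values.
-/
theorem eisCount_prime_pow_mul {p : ℕ} (hp : p.Prime) (h3 : p ≠ 3) {k : ℕ} (hk : ¬ p ∣ k) :
    ∀ a : ℕ, eisCount (p ^ a * k) = (∑ i ∈ Finset.range (a + 1), chi p ^ i) * eisCount k ∧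
      eisCount (p ^ (a + 1) * k) =
        (∑ i ∈ Finset.range (a + 2), chi p ^ i) * eisCount k := by
  intro a
  induction a with
  | zero =>
    have h := eisCount_prime_mul hp h3 (k := k)
    rw [eisSet_dvd_eq_empty hp (by exact_mod_cast hk)] at h
    simp only [Set.ncard_empty, Nat.cast_zero, mul_zero, add_zero] at h
    simp [h, Finset.sum_range_succ]
  | succ a ih =>
    refine ⟨ih.2, ?_⟩
    have h := eisCount_prime_mul hp h3 (k := p * (p ^ a * k))
    rw [Nat.cast_mul, ncard_eisSet_dvd hp] at h
    have e1 : p ^ (a + 1 + 1) * k = p * (p * (p ^ a * k)) := by ring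
    have e2 : p * (p ^ a * k) = p ^ (a + 1) * k := by ring
    have h' : eisCount (p * (p * (p ^ a * k))) + chi p * eisCount (p ^ a * k) =
      (1 + chi p) * eisCount (p * (p ^ a * k)) := h
    rw [e1, eq_sub_of_add_eq h', e2, ih.1, ih.2, Finset.sum_range_succ _ (a + 1 + 1),
      Finset.sum_range_succ _ (a + 1)]
    have h4 := Finset.sum_range_succ (fun i => chi p ^ i) (a + 1)
    ring

theorem eisCount_one : eisCount 1 = 6 := by
  have : eisSet (1 : ℕ) = (({(1, 0), (-1, 0), (0, 1), (0, -1), (1, 1), (-1, -1)} :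
      Finset (ℤ × ℤ)) : Set (ℤ × ℤ)) := by
    ext ⟨x, y⟩
    rw [mem_eisSet]
    simp only [Finset.coe_insert, Finset.coe_singleton, Set.mem_insert_iff, Set.mem_singleton_iff,
      Prod.mk.injEq, Nat.cast_one]
    constructor
    · intro h
      have h1 : x ^ 2 ≤ 1 := by nlinarith [sq_nonneg (x - 2 * y)]
      have h2 : y ^ 2 ≤ 1 := by nlinarith [sq_nonneg (y - 2 * x)]
      rw [sq_le_one_iff_abs_le_one, abs_le] at h1 h2
      obtain ⟨h3, h4⟩ := h1
      obtain ⟨h5, h6⟩ := h2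
      interval_cases x <;> interval_cases y <;> simp_all
    · rintro (⟨rfl, rfl⟩ | ⟨rfl, rfl⟩ | ⟨rfl, rfl⟩ | ⟨rfl, rfl⟩ | ⟨rfl, rfl⟩ | ⟨rfl, rfl⟩) <;>
        norm_num
  rw [eisCount, this, Set.ncard_coe_finset]
  rfl

theorem eisCount_eq {m : ℕ} (h3 : ¬ 3 ∣ m) : eisCount m = 6 * divSum m := by
  induction m using Nat.strong_induction_on with
  | _ m ih =>
    rcases eq_or_ne m 1 with rfl | h1
    · rw [eisCount_one]
      simp [divSum, chi_one]
    · have hm0 : m ≠ 0 := by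
        rintro rfl
        simp at h3
      set p := m.minFac with hpdef
      have hp : p.Prime := Nat.minFac_prime h1
      obtain ⟨a, k, hk, hmk⟩ := Nat.exists_eq_pow_mul_and_not_dvd hm0 p hp.ne_one
      have hpm : p ∣ m := Nat.minFac_dvd m
      have hp3 : p ≠ 3 := fun h => h3 (h ▸ hpm)
      have hk0 : 0 < k := Nat.pos_of_ne_zero (by rintro rfl; simp at hk)
      have ha : a ≠ 0 := by
        rintro rfl
        rw [pow_zero, one_mul] at hmk
        exact hk (hmk ▸ hpm)
      have hlt : k < m := by
        rw [hmk]
        exact lt_mul_of_one_lt_left hk0 (one_lt_pow₀ hp.one_lt ha)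
      have h3k : ¬ 3 ∣ k := fun h => h3 (by rw [hmk]; exact h.mul_left _)
      rw [hmk, (eisCount_prime_pow_mul hp hp3 hk a).1, ih k hlt h3k, divSum_mul,
        divSum_prime_pow hp]
      · ring
      · exact Nat.Coprime.pow_left a ((Nat.Prime.coprime_iff_not_dvd hp).2 hk)

/-! ### From 3-cores to Eisenstein integers of norm 3n + 1. -/

/-- The pairs parametrizing the `3`-cores of size `n`. -/
def coreSet (n : ℕ) : Set (ℕ × ℕ) := {p | p.1 * p.1 + p.2 * p.2 + p.2 = n + p.1 * p.2}

/-- The Eisenstein integer `(a - 2 b - 1) + (2 a - b) ω` times the six roots of unity. -/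
def coreToEis (q : (ℕ × ℕ) × Fin 6) : ℤ × ℤ :=
  let a : ℤ := q.1.1
  let b : ℤ := q.1.2
  match q.2 with
  | 0 => (a - 2 * b - 1, 2 * a - b)
  | 1 => (b - 2 * a, -a - b - 1)
  | 2 => (a + b + 1, 2 * b - a + 1)
  | 3 => (2 * b + 1 - a, b - 2 * a)
  | 4 => (2 * a - b, a + b + 1)
  | 5 => (-a - b - 1, a - 2 * b - 1)

theorem coreToEis_injective : Function.Injective coreToEis := by
  rintro ⟨⟨a, b⟩, i⟩ ⟨⟨a', b'⟩, j⟩ h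
  have key : a = a' ∧ b = b' ∧ i = j := by
    fin_cases i <;> fin_cases j <;>
      simp only [coreToEis, Prod.mk.injEq] at h <;>
      first
      | exact ⟨by omega, by omega, rfl⟩
      | omega
  obtain ⟨rfl, rfl, rfl⟩ := key
  rfl

theorem coreToEis_mem_iff {n : ℕ} (q : (ℕ × ℕ) × Fin 6) :
    coreToEis q ∈ eisSet ((3 * n + 1 : ℕ) : ℤ) ↔ q.1 ∈ coreSet n := by
  obtain ⟨⟨a, b⟩, i⟩ := q
  have h1 : (a, b) ∈ coreSet n ↔ (a * a + b * b + b : ℤ) = n + a * b := by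
    simp only [coreSet, Set.mem_ofPred_eq]
    exact_mod_cast Iff.rfl
  rw [h1]
  fin_cases i <;>
  · simp only [coreToEis, mem_eisSet]
    push_cast
    constructor <;> intro h <;> nlinarith

/-- Such a norm forces `x + y` to be prime to 3, and a sign makes it 2 modulo 3. Then `x = a - 2 * b
- 1`, `y = 2 * a - b` has an integer solution, and exactly one of the three rotations by cube roots
of unity brings it to the sector `a, b ≥ 0`. -/
theorem exists_coreToEis_eq {n : ℕ} {v : ℤ × ℤ} (hv : v ∈ eisSet ((3 * n + 1 : ℕ) : ℤ)) :
    ∃ q, coreToEis q = v := by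
  obtain ⟨x, y⟩ := v
  rw [mem_eisSet] at hv
  push_cast at hv
  have key : ∀ x y : ℤ, (x + y) % 3 = 2 →
      ∃ a b : ℕ, (x = a - 2 * b - 1 ∧ y = 2 * a - b) ∨ (x = b - 2 * a ∧ y = -a - b - 1) ∨
        (x = a + b + 1 ∧ y = 2 * b - a + 1) := by
    intro x y h
    obtain ⟨a, ha⟩ : ∃ a : ℤ, 2 * y - x = 3 * a + 1 := ⟨(2 * y - x) / 3, by omega⟩
    obtain ⟨b, hb⟩ : ∃ b : ℤ, y - 2 * x = 3 * b + 2 := ⟨(y - 2 * x) / 3, by omega⟩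
    by_cases h1 : 0 ≤ a ∧ 0 ≤ b
    · exact ⟨a.toNat, b.toNat, Or.inl (by omega)⟩
    by_cases h2 : a < 0 ∧ a ≤ b
    · exact ⟨(b - a).toNat, (-a - 1).toNat, Or.inr (Or.inl (by omega))⟩
    · exact ⟨(-b - 1).toNat, (a - b - 1).toNat, Or.inr (Or.inr (by omega))⟩
  have h3 : (x + y) % 3 = 1 ∨ (x + y) % 3 = 2 := by
    have h4 : ¬ (3 : ℤ) ∣ x + y := by
      rintro ⟨k, hk⟩
      have e : 3 * (3 * k ^ 2 - x * y) = 3 * n + 1 := by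
        rw [← hv]
        linear_combination (-(x + y) - 3 * k) * hk
      omega
    omega
  rcases h3 with h3 | h3
  · obtain ⟨a, b, h | h | h⟩ := key (-x) (-y) (by omega)
    · exact ⟨((a, b), 3), Prod.ext (by simp only [coreToEis]; omega) (by simp only [coreToEis]; omega)⟩
    · exact ⟨((a, b), 4), Prod.ext (by simp only [coreToEis]; omega) (by simp only [coreToEis]; omega)⟩
    · exact ⟨((a, b), 5), Prod.ext (by simp only [coreToEis]; omega) (by simp only [coreToEis]; omega)⟩
  · obtain ⟨a, b, h | h | h⟩ := key x y h3
    · exact ⟨((a, b), 0), Prod.ext (by simp only [coreToEis]; omega) (by simp only [coreToEis]; omega)⟩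
    · exact ⟨((a, b), 1), Prod.ext (by simp only [coreToEis]; omega) (by simp only [coreToEis]; omega)⟩
    · exact ⟨((a, b), 2), Prod.ext (by simp only [coreToEis]; omega) (by simp only [coreToEis]; omega)⟩

theorem ncard_coreSet (n : ℕ) : ((coreSet n).ncard : ℤ) = divSum (3 * n + 1) := by
  have h : eisSet ((3 * n + 1 : ℕ) : ℤ) = coreToEis '' (coreSet n ×ˢ Set.univ) := by
    ext v
    constructor
    · intro hv
      obtain ⟨q, rfl⟩ := exists_coreToEis_eq hv
      exact ⟨q, ⟨(coreToEis_mem_iff q).1 hv, trivial⟩, rfl⟩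
    · rintro ⟨q, hq, rfl⟩
      exact (coreToEis_mem_iff q).2 hq.1
  have h1 := eisCount_eq (m := 3 * n + 1) (by omega)
  rw [eisCount, h, Set.ncard_image_of_injective _ coreToEis_injective, Set.ncard_prod,
    Set.ncard_univ, Nat.card_eq_fintype_card, Fintype.card_fin] at h1
  push_cast at h1
  omega

/-! ### Triples of cores as a convolution. -/

theorem ncard_add_eq_sum_antidiagonal {α β : Type*} {P : α → Prop} {Q : β → Prop}
    {f : α → ℕ} {g : β → ℕ} (hf : ∀ i, {x | P x ∧ f x = i}.Finite)
    (hg : ∀ i, {x | Q x ∧ g x = i}.Finite) (n : ℕ) :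
    {p : α × β | (P p.1 ∧ Q p.2) ∧ f p.1 + g p.2 = n}.Finite ∧
    {p : α × β | (P p.1 ∧ Q p.2) ∧ f p.1 + g p.2 = n}.ncard =
      ∑ ij ∈ Finset.HasAntidiagonal.antidiagonal n,
        {x | P x ∧ f x = ij.1}.ncard * {x | Q x ∧ g x = ij.2}.ncard := by
  classical
  have h : {p : α × β | (P p.1 ∧ Q p.2) ∧ f p.1 + g p.2 = n} =
      ((Finset.HasAntidiagonal.antidiagonal n).biUnion fun ij => (hf ij.1).toFinset ×ˢ (hg ij.2).toFinset :
        Finset (α × β)) := by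
    ext ⟨x, y⟩
    simp only [Set.mem_ofPred_eq, Finset.coe_biUnion, Finset.mem_coe, Finset.HasAntidiagonal.mem_antidiagonal,
      Finset.coe_product, Set.Finite.coe_toFinset, Set.mem_iUnion, Set.mem_prod, exists_prop,
      Prod.exists]
    constructor
    · rintro ⟨⟨hP, hQ⟩, hn⟩
      exact ⟨_, _, hn, ⟨hP, rfl⟩, hQ, rfl⟩
    · rintro ⟨i, j, hn, ⟨hP, rfl⟩, hQ, rfl⟩
      exact ⟨⟨hP, hQ⟩, hn⟩
  rw [h]
  refine ⟨Finset.finite_toSet _, ?_⟩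
  rw [Set.ncard_coe_finset, Finset.card_biUnion]
  · refine Finset.sum_congr rfl fun ij _ => ?_
    rw [Finset.card_product, Set.ncard_eq_toFinset_card _ (hf _),
      Set.ncard_eq_toFinset_card _ (hg _)]
  · rintro ⟨i, j⟩ - ⟨i', j'⟩ - hne
    rw [Function.onFun, Finset.disjoint_left]
    rintro ⟨x, y⟩ h1 h2
    simp only [Finset.mem_product, Set.Finite.mem_toFinset, Set.mem_ofPred_eq] at h1 h2
    refine hne (Prod.ext ?_ ?_)
    · exact h1.1.2.symm.trans h2.1.2
    · exact h1.2.2.symm.trans h2.2.2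

theorem coe_B_three (n : ℕ) : (B 3 n : ℤ) = ∑ p ∈ Finset.HasAntidiagonal.antidiagonal n,
    divSum (3 * p.1 + 1) *
      ∑ q ∈ Finset.HasAntidiagonal.antidiagonal p.2, divSum (3 * q.1 + 1) * divSum (3 * q.2 + 1) := by
  have hfin : ∀ i, {μ : YoungDiagram | μ.IsCore 3 ∧ μ.card = i}.Finite := fun i =>
    (YoungDiagram.finite_card_le i).subset fun μ h => le_of_eq h.2
  have h2 := ncard_add_eq_sum_antidiagonal hfin hfin
  have h3 := ncard_add_eq_sum_antidiagonal hfin (fun i => (h2 i).1) n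
  have e : coreTriples 3 n = {p : YoungDiagram × YoungDiagram × YoungDiagram |
      (p.1.IsCore 3 ∧ p.2.1.IsCore 3 ∧ p.2.2.IsCore 3) ∧
        p.1.card + (p.2.1.card + p.2.2.card) = n} := by
    ext p
    simp only [coreTriples, Set.mem_ofPred_eq, and_assoc, add_assoc]
  have hD : ∀ i, ({μ : YoungDiagram | μ.IsCore 3 ∧ μ.card = i}.ncard : ℤ) =
      divSum (3 * i + 1) := fun i => by
    rw [YoungDiagram.ncard_isCore_three]
    exact ncard_coreSet i
  rw [B, e, h3.2]
  push_cast
  refine Finset.sum_congr rfl fun p _ => ?_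
  rw [(h2 p.2).2, hD]
  push_cast
  simp only [hD]

/-! ### Liouville's method. -/

/-- The quadruples `(d, d', e, e')` of positive integers with `d * e + d' * e' = n`. -/
def quads (n : ℕ) : Finset (ℕ × ℕ × ℕ × ℕ) :=
  (Finset.Icc 1 n ×ˢ Finset.Icc 1 n ×ˢ Finset.Icc 1 n ×ˢ Finset.Icc 1 n).filter
    fun v => v.1 * v.2.2.1 + v.2.1 * v.2.2.2 = n

theorem mem_quads {n d d' e e' : ℕ} : (d, d', e, e') ∈ quads n ↔
    (0 < d ∧ 0 < d' ∧ 0 < e ∧ 0 < e') ∧ d * e + d' * e' = n := by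
  simp only [quads, Finset.mem_filter, Finset.mem_product, Finset.mem_Icc]
  constructor
  · rintro ⟨h, h'⟩
    exact ⟨by omega, h'⟩
  · rintro ⟨⟨h1, h2, h3, h4⟩, rfl⟩
    have := Nat.le_mul_of_pos_right d h3
    have := Nat.le_mul_of_pos_left e h1
    have := Nat.le_mul_of_pos_right d' h4
    have := Nat.le_mul_of_pos_left e' h2
    refine ⟨⟨⟨h1, ?_⟩, ⟨h2, ?_⟩, ⟨h3, ?_⟩, h4, ?_⟩, rfl⟩ <;> omega

theorem sum_quads_swap (n : ℕ) (f : ℕ → ℕ → ℕ → ℕ → ℤ) :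
    ∑ v ∈ quads n, f v.1 v.2.1 v.2.2.1 v.2.2.2 = ∑ v ∈ quads n, f v.2.1 v.1 v.2.2.2 v.2.2.1 := by
  refine Finset.sum_nbij' (fun v => (v.2.1, v.1, v.2.2.2, v.2.2.1))
    (fun v => (v.2.1, v.1, v.2.2.2, v.2.2.1)) ?_ ?_ ?_ ?_ ?_
  · rintro ⟨d, d', e, e'⟩ h
    rw [mem_quads] at h ⊢
    exact ⟨by tauto, by rw [← h.2, add_comm]⟩
  · rintro ⟨d, d', e, e'⟩ h
    rw [mem_quads] at h ⊢
    exact ⟨by tauto, by rw [← h.2, add_comm]⟩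
  all_goals simp

theorem sum_quads_transpose (n : ℕ) (f : ℕ → ℕ → ℕ → ℕ → ℤ) :
    ∑ v ∈ quads n, f v.1 v.2.1 v.2.2.1 v.2.2.2 = ∑ v ∈ quads n, f v.2.2.1 v.2.1 v.1 v.2.2.2 := by
  refine Finset.sum_nbij' (fun v => (v.2.2.1, v.2.1, v.1, v.2.2.2))
    (fun v => (v.2.2.1, v.2.1, v.1, v.2.2.2)) ?_ ?_ ?_ ?_ ?_
  · rintro ⟨d, d', e, e'⟩ h
    rw [mem_quads] at h ⊢
    exact ⟨by tauto, by rw [← h.2, mul_comm e]⟩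
  · rintro ⟨d, d', e, e'⟩ h
    rw [mem_quads] at h ⊢
    exact ⟨by tauto, by rw [← h.2, mul_comm e]⟩
  all_goals simp

theorem sum_quads_eq_zero (n : ℕ) (f : ℕ → ℕ → ℕ → ℕ → ℤ)
    (hf : ∀ d d' e e', f e d' d e' = -f d d' e e') :
    ∑ v ∈ quads n, f v.1 v.2.1 v.2.2.1 v.2.2.2 = 0 := by
  have h := sum_quads_transpose n f
  have h1 : ∑ v ∈ quads n, f v.2.2.1 v.2.1 v.1 v.2.2.2 =
      ∑ v ∈ quads n, -f v.1 v.2.1 v.2.2.1 v.2.2.2 := Finset.sum_congr rfl fun v _ => hf _ _ _ _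
  rw [h1, Finset.sum_neg_distrib] at h
  omega

theorem sum_quads_split (n : ℕ) (f : ℕ → ℕ → ℕ → ℕ → ℤ)
    (hf : ∀ d d' e e', f d d' e e' = f d' d e' e) :
    ∑ v ∈ quads n, f v.1 v.2.1 v.2.2.1 v.2.2.2 =
      (∑ v ∈ quads n, if v.2.2.1 = v.2.2.2 then f v.1 v.2.1 v.2.2.1 v.2.2.2 else 0) +
      2 * ∑ v ∈ quads n, if v.2.2.1 < v.2.2.2 then f v.1 v.2.1 v.2.2.1 v.2.2.2 else 0 := by
  have h := sum_quads_swap n fun d d' e e' => if e < e' then f d d' e e' else 0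
  rw [two_mul]
  nth_rewrite 2 [h]
  rw [← Finset.sum_add_distrib, ← Finset.sum_add_distrib]
  refine Finset.sum_congr rfl fun v _ => ?_
  have := hf v.1 v.2.1 v.2.2.1 v.2.2.2
  split_ifs <;> omega

theorem sum_quads_split' (n : ℕ) (f : ℕ → ℕ → ℕ → ℕ → ℤ)
    (hf : ∀ d d' e e', f d d' e e' = f d' d e' e) :
    ∑ v ∈ quads n, f v.1 v.2.1 v.2.2.1 v.2.2.2 =
      (∑ v ∈ quads n, if v.1 = v.2.1 then f v.1 v.2.1 v.2.2.1 v.2.2.2 else 0) +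
      2 * ∑ v ∈ quads n, if v.2.1 < v.1 then f v.1 v.2.1 v.2.2.1 v.2.2.2 else 0 := by
  have h := sum_quads_swap n fun d d' e e' => if d' < d then f d d' e e' else 0
  rw [two_mul]
  nth_rewrite 2 [h]
  rw [← Finset.sum_add_distrib, ← Finset.sum_add_distrib]
  refine Finset.sum_congr rfl fun v _ => ?_
  have := hf v.1 v.2.1 v.2.2.1 v.2.2.2
  split_ifs <;> omega

/-- A summation formula in the style of Liouville, based on the bijection
`(d, d', e, e') ↦ (d + d', d', e, e' - e)`. -/
theorem liouville (n : ℕ) (f g : ℕ → ℕ → ℕ → ℕ → ℤ)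
    (hf : ∀ d d' e e', f d d' e e' = f d' d e' e) (hg : ∀ d d' e e', g d d' e e' = g d' d e' e)
    (hfg : ∀ x y z w, g (x + y) y z w = f x y z (z + w)) :
    ∑ v ∈ quads n, (f v.1 v.2.1 v.2.2.1 v.2.2.2 - g v.1 v.2.1 v.2.2.1 v.2.2.2) =
      (∑ v ∈ quads n, if v.2.2.1 = v.2.2.2 then f v.1 v.2.1 v.2.2.1 v.2.2.2 else 0) -
      ∑ v ∈ quads n, if v.1 = v.2.1 then g v.1 v.2.1 v.2.2.1 v.2.2.2 else 0 := by
  -- By symmetry each sum is a diagonal plus twice one half; the bijection matches the half `e < e'`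
  -- for `f` with the half `d' < d` for `g`, so only the diagonals survive.
  rw [Finset.sum_sub_distrib, sum_quads_split n f hf, sum_quads_split' n g hg]
  have key : (∑ v ∈ quads n, if v.2.2.1 < v.2.2.2 then f v.1 v.2.1 v.2.2.1 v.2.2.2 else 0) =
      ∑ v ∈ quads n, if v.2.1 < v.1 then g v.1 v.2.1 v.2.2.1 v.2.2.2 else 0 := by
    rw [← Finset.sum_filter, ← Finset.sum_filter]
    refine Finset.sum_nbij' (fun v => (v.1 + v.2.1, v.2.1, v.2.2.1, v.2.2.2 - v.2.2.1))
      (fun v => (v.1 - v.2.1, v.2.1, v.2.2.1, v.2.2.2 + v.2.2.1)) ?_ ?_ ?_ ?_ ?_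
    · rintro ⟨d, d', e, e'⟩ h
      rw [Finset.mem_filter, mem_quads] at h ⊢
      obtain ⟨⟨h1, h2⟩, h3⟩ := h
      simp only at h3
      obtain ⟨c, rfl⟩ := Nat.exists_eq_add_of_lt h3
      refine ⟨⟨by dsimp only; omega, ?_⟩, by simp only; omega⟩
      have e1 : e + c + 1 - e = c + 1 := by omega
      simp only [e1]
      rw [← h2]
      ring
    · rintro ⟨d, d', e, e'⟩ h
      rw [Finset.mem_filter, mem_quads] at h ⊢
      obtain ⟨⟨h1, h2⟩, h3⟩ := h
      simp only at h3
      obtain ⟨c, rfl⟩ := Nat.exists_eq_add_of_lt h3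
      refine ⟨⟨by dsimp only; omega, ?_⟩, by simp only; omega⟩
      have e1 : d' + c + 1 - d' = c + 1 := by omega
      simp only [e1]
      rw [← h2]
      ring
    · rintro ⟨d, d', e, e'⟩ h
      rw [Finset.mem_filter] at h
      have h3 := h.2
      simp only at h3
      simp only [Prod.mk.injEq, true_and]
      omega
    · rintro ⟨d, d', e, e'⟩ h
      rw [Finset.mem_filter] at h
      have h3 := h.2
      simp only at h3
      simp only [Prod.mk.injEq, true_and]
      omega
    · rintro ⟨d, d', e, e'⟩ h
      rw [Finset.mem_filter] at h
      have h3 := h.2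
      simp only at h3
      simp only [hfg]
      rw [Nat.add_sub_cancel' h3.le]
  rw [key]
  ring

theorem sum_quads_mul (n : ℕ) (f g : ℕ → ℕ → ℤ) :
    ∑ v ∈ quads n, f v.1 v.2.2.1 * g v.2.1 v.2.2.2 =
      ∑ p ∈ Finset.HasAntidiagonal.antidiagonal n,
        (∑ x ∈ p.1.divisorsAntidiagonal, f x.1 x.2) *
          ∑ y ∈ p.2.divisorsAntidiagonal, g y.1 y.2 := by
  simp only [Finset.sum_mul_sum, ← Finset.sum_product']
  rw [Finset.sum_sigma']
  refine Finset.sum_nbij' (fun v => ⟨(v.1 * v.2.2.1, v.2.1 * v.2.2.2),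
    ((v.1, v.2.2.1), (v.2.1, v.2.2.2))⟩)
    (fun w => (w.2.1.1, w.2.2.1, w.2.1.2, w.2.2.2)) ?_ ?_ ?_ ?_ ?_
  · rintro ⟨d, d', e, e'⟩ h
    rw [mem_quads] at h
    obtain ⟨⟨h1, h2, h3, h4⟩, h5⟩ := h
    simp only [Finset.mem_sigma, Finset.HasAntidiagonal.mem_antidiagonal, Finset.mem_product,
      Nat.mem_divisorsAntidiagonal, true_and]
    exact ⟨h5, (Nat.mul_pos h1 h3).ne', (Nat.mul_pos h2 h4).ne'⟩
  · rintro ⟨⟨u, v⟩, ⟨d, e⟩, ⟨d', e'⟩⟩ h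
    simp only [Finset.mem_sigma, Finset.HasAntidiagonal.mem_antidiagonal, Finset.mem_product,
      Nat.mem_divisorsAntidiagonal] at h
    obtain ⟨h1, ⟨rfl, h2⟩, rfl, h3⟩ := h
    rw [mem_quads]
    refine ⟨?_, h1⟩
    simp only [ne_eq, mul_eq_zero] at h2 h3
    dsimp only
    omega
  · rintro ⟨d, d', e, e'⟩ h
    rfl
  · rintro ⟨⟨u, v⟩, ⟨d, e⟩, ⟨d', e'⟩⟩ h
    simp only [Finset.mem_sigma, Finset.HasAntidiagonal.mem_antidiagonal, Finset.mem_product,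
      Nat.mem_divisorsAntidiagonal] at h
    obtain ⟨h1, ⟨rfl, h2⟩, rfl, h3⟩ := h
    rfl
  · rintro ⟨d, d', e, e'⟩ h
    rfl

theorem sum_quads_diag (n : ℕ) (f : ℕ → ℕ → ℕ → ℤ) :
    (∑ v ∈ quads n, if v.1 = v.2.1 then f v.1 v.2.2.1 v.2.2.2 else 0) =
      ∑ p ∈ n.divisorsAntidiagonal, ∑ e ∈ Finset.Ico 1 p.2, f p.1 e (p.2 - e) := by
  rw [← Finset.sum_filter, Finset.sum_sigma']
  refine Finset.sum_nbij' (fun v => ⟨(v.1, v.2.2.1 + v.2.2.2), v.2.2.1⟩)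
    (fun w => (w.1.1, w.1.1, w.2, w.1.2 - w.2)) ?_ ?_ ?_ ?_ ?_
  · rintro ⟨d, d', e, e'⟩ h
    rw [Finset.mem_filter, mem_quads] at h
    obtain ⟨⟨⟨h1, h2, h3, h4⟩, h5⟩, h6⟩ := h
    simp only at h6
    subst h6
    simp only [Finset.mem_sigma, Nat.mem_divisorsAntidiagonal, Finset.mem_Ico]
    refine ⟨⟨by rw [← h5, mul_add], ?_⟩, by omega, by omega⟩
    have := Nat.mul_pos h1 h3
    omega
  · rintro ⟨⟨d, D⟩, e⟩ h
    simp only [Finset.mem_sigma, Nat.mem_divisorsAntidiagonal, Finset.mem_Ico] at h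
    obtain ⟨⟨rfl, h1⟩, h2, h3⟩ := h
    rw [Finset.mem_filter, mem_quads]
    simp only [ne_eq, mul_eq_zero] at h1
    refine ⟨⟨by dsimp only; omega, ?_⟩, rfl⟩
    rw [← mul_add, Nat.add_sub_cancel' h3.le]
  · rintro ⟨d, d', e, e'⟩ h
    rw [Finset.mem_filter] at h
    have h3 := h.2
    simp only at h3
    simp only [Prod.mk.injEq, true_and]
    omega
  · rintro ⟨⟨d, D⟩, e⟩ h
    simp only [Finset.mem_sigma, Finset.mem_Ico] at h
    simp only [Nat.add_sub_cancel' h.2.2.le]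
  · rintro ⟨d, d', e, e'⟩ h
    simp

theorem sum_quads_diag' (n : ℕ) (f : ℕ → ℕ → ℕ → ℤ) :
    (∑ v ∈ quads n, if v.2.2.1 = v.2.2.2 then f v.2.2.1 v.1 v.2.1 else 0) =
      ∑ p ∈ n.divisorsAntidiagonal, ∑ d ∈ Finset.Ico 1 p.2, f p.1 d (p.2 - d) := by
  rw [← sum_quads_diag]
  refine Finset.sum_nbij' (fun v => (v.2.2.1, v.2.2.2, v.1, v.2.1))
    (fun v => (v.2.2.1, v.2.2.2, v.1, v.2.1)) ?_ ?_ ?_ ?_ ?_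
  · rintro ⟨d, d', e, e'⟩ h
    rw [mem_quads] at h ⊢
    exact ⟨by tauto, by rw [← h.2, mul_comm e, mul_comm e']⟩
  · rintro ⟨d, d', e, e'⟩ h
    rw [mem_quads] at h ⊢
    exact ⟨by tauto, by rw [← h.2, mul_comm e, mul_comm e']⟩
  all_goals simp

/-! ### The twofold convolution. -/

/-- The nontrivial character modulo `3` on residue classes. -/
def chiZ (x : ZMod 3) : ℤ := if x = 1 then 1 else if x = 2 then -1 else 0

theorem natCast_zmod_three_eq_iff (n c : ℕ) (hc : c < 3) : (n : ZMod 3) = c ↔ n % 3 = c := by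
  rw [ZMod.natCast_eq_natCast_iff', Nat.mod_eq_of_lt hc]

theorem natCast_zmod_three_eq_one_iff (n : ℕ) : (n : ZMod 3) = 1 ↔ n % 3 = 1 := by
  simpa using natCast_zmod_three_eq_iff n 1 (by norm_num)

theorem natCast_zmod_three_eq_two_iff (n : ℕ) : (n : ZMod 3) = 2 ↔ n % 3 = 2 := by
  simpa using natCast_zmod_three_eq_iff n 2 (by norm_num)

theorem chi_eq_chiZ (n : ℕ) : chi n = chiZ n := by
  simp only [chi, chiZ, natCast_zmod_three_eq_one_iff, natCast_zmod_three_eq_two_iff]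

theorem sum_antidiagonal_three_mul (k r s : ℕ) (H : ℕ → ℕ → ℤ)
    (hH : ∀ u v, ¬ (u % 3 = r ∧ v % 3 = s) → H u v = 0) :
    ∑ p ∈ Finset.HasAntidiagonal.antidiagonal k, H (3 * p.1 + r) (3 * p.2 + s) =
      ∑ p ∈ Finset.HasAntidiagonal.antidiagonal (3 * k + (r + s)), H p.1 p.2 := by
  refine Finset.sum_of_injOn (fun p => (3 * p.1 + r, 3 * p.2 + s)) ?_ ?_ ?_ fun _ _ => rfl
  · rintro ⟨i, j⟩ - ⟨i', j'⟩ - h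
    simp only [Prod.mk.injEq] at h ⊢
    omega
  · rintro ⟨i, j⟩ h
    simp only [Finset.mem_coe, Finset.HasAntidiagonal.mem_antidiagonal] at h ⊢
    omega
  · rintro ⟨u, v⟩ h h'
    rw [Finset.HasAntidiagonal.mem_antidiagonal] at h
    apply hH
    rintro ⟨hu, hv⟩
    simp only at h hu hv
    refine h' ⟨(u / 3, v / 3), ?_, ?_⟩
    · simp only [Finset.mem_coe, Finset.HasAntidiagonal.mem_antidiagonal]
      omega
    · simp only [Prod.mk.injEq]
      omega

/-- With the condition on `u` moved to its two factors, the weights become functions of residues in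
`ZMod 3`, where identities can be settled by `decide`. -/
theorem sum_divisorsAntidiagonal_ite (u : ℕ) (c : ZMod 3) (f : ℕ → ℤ) :
    ∑ x ∈ u.divisorsAntidiagonal, (if (x.1 : ZMod 3) * x.2 = c then f x.1 else 0) =
      if (u : ZMod 3) = c then ∑ d ∈ u.divisors, f d else 0 := by
  have h : ∀ x ∈ u.divisorsAntidiagonal, (if (x.1 : ZMod 3) * x.2 = c then f x.1 else 0) =
      if (u : ZMod 3) = c then f x.1 else 0 := fun x hx => by
    rw [← (Nat.mem_divisorsAntidiagonal.1 hx).1, Nat.cast_mul]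
  rw [Finset.sum_congr rfl h]
  split_ifs
  · rw [← Nat.map_div_right_divisors, Finset.sum_map]
    rfl
  · simp

theorem sum_chi_divisors_eq_zero {m : ℕ} (h : m % 3 = 2) :
    ∑ p ∈ m.divisorsAntidiagonal, chi p.2 = 0 := by
  have h1 : ∑ p ∈ m.divisorsAntidiagonal, chi p.2 = ∑ p ∈ m.divisorsAntidiagonal, chi p.1 := by
    rw [← Nat.map_swap_divisorsAntidiagonal, Finset.sum_map]
    simp
  have h2 : ∑ p ∈ m.divisorsAntidiagonal, chi p.2 =
      ∑ p ∈ m.divisorsAntidiagonal, -chi p.1 := by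
    refine Finset.sum_congr rfl fun p hp => ?_
    have h3 := (Nat.mem_divisorsAntidiagonal.1 hp).1
    have h4 : chi p.1 * chi p.2 = -1 := by
      rw [← chi_mul, h3]
      simp [chi, h]
    rcases Int.mul_eq_neg_one_iff_eq_one_or_neg_one.1 h4 with ⟨h5, h6⟩ | ⟨h5, h6⟩ <;> simp [h5, h6]
  rw [Finset.sum_neg_distrib] at h2
  omega

theorem sum_Ico_mod_three_eq_one (m : ℕ) :
    ∑ e ∈ Finset.Ico 1 (3 * m + 2), (if e % 3 = 1 then 1 else 0 : ℤ) = m + 1 := by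
  induction m with
  | zero => rfl
  | succ m ih =>
    have e : 3 * (m + 1) + 2 = 3 * m + 2 + 1 + 1 + 1 := by ring
    rw [e, Finset.sum_Ico_succ_top (by omega), Finset.sum_Ico_succ_top (by omega),
      Finset.sum_Ico_succ_top (by omega), ih]
    rw [if_neg (by omega), if_neg (by omega), if_pos (by omega)]
    push_cast
    ring

theorem sum_Ico_mod_three_eq_two (m : ℕ) :
    ∑ e ∈ Finset.Ico 1 (3 * m + 1), (if e % 3 = 2 then 1 else 0 : ℤ) = m := by
  induction m with
  | zero => rfl
  | succ m ih =>
    have e : 3 * (m + 1) + 1 = 3 * m + 1 + 1 + 1 + 1 := by ring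
    rw [e, Finset.sum_Ico_succ_top (by omega), Finset.sum_Ico_succ_top (by omega),
      Finset.sum_Ico_succ_top (by omega), ih]
    rw [if_neg (by omega), if_pos (by omega), if_neg (by omega)]
    push_cast
    ring

theorem sum_Ico_mod_three_ne_zero (m : ℕ) :
    ∑ e ∈ Finset.Ico 1 (3 * m), (if e % 3 = 0 then 0 else 1 : ℤ) = 2 * m := by
  induction m with
  | zero => rfl
  | succ m ih =>
    rcases Nat.eq_zero_or_pos m with rfl | hm
    · rfl
    have e : 3 * (m + 1) = 3 * m + 1 + 1 + 1 := by ring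
    rw [e, Finset.sum_Ico_succ_top (by omega), Finset.sum_Ico_succ_top (by omega),
      Finset.sum_Ico_succ_top (by omega), ih]
    rw [if_pos (by omega), if_neg (by omega), if_neg (by omega)]
    push_cast
    ring

/-- The function to which Liouville's formula is applied for the square. -/
def sqF (a b c d : ZMod 3) : ℤ :=
  if (a = 0 ∧ b ≠ 0 ∧ b = c ∧ d = -c) ∨ (b = 0 ∧ a ≠ 0 ∧ a = d ∧ c = -d) ∨
    (a ≠ 0 ∧ a = c ∧ b = d ∧ b = -a) then -1 else 0

/-- The companion of `sqF` in Liouville's formula. -/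
def sqG (a b c d : ZMod 3) : ℤ :=
  if (a = 0 ∧ b ≠ 0 ∧ c = d ∧ d = -b) ∨ (b = 0 ∧ a ≠ 0 ∧ c = d ∧ d = -a) ∨
    (a ≠ 0 ∧ a = b ∧ b = c ∧ c = d) then -1 else 0

/-- The part of `sqF - sqG` that does not contribute to the sum. -/
def sqE (a b c d : ZMod 3) : ℤ :=
  if b = 0 ∧ a * c = 2 then -chiZ a * chiZ d else 0

/-- The product on the right is the summand of the convolution. `sqE` changes sign when `d` and `e`
are exchanged, so its sum over `quads` vanishes. -/
theorem sqF_sub_sqG : ∀ a b c d : ZMod 3, sqF a b c d - sqG a b c d =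
    (if a * c = 1 then chiZ a else 0) * (if b * d = 1 then chiZ b else 0) +
      (sqE a b c d + sqE b a d c) := by
  decide

theorem mod_three_of_mul_mod_three {d D : ℕ} (h : (d * D) % 3 = 2) :
    (d % 3 = 1 ∧ D % 3 = 2) ∨ (d % 3 = 2 ∧ D % 3 = 1) := by
  rw [Nat.mul_mod] at h
  have key : ∀ a < 3, ∀ b < 3, a * b % 3 = 2 → (a = 1 ∧ b = 2) ∨ (a = 2 ∧ b = 1) := by decide
  exact key _ (Nat.mod_lt _ (by norm_num)) _ (Nat.mod_lt _ (by norm_num)) h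

theorem sum_sqG {d D : ℕ} (h : (d * D) % 3 = 2) :
    -(3 * ∑ e ∈ Finset.Ico 1 D, sqG d d e ((D - e : ℕ) : ZMod 3)) = D - chi D := by
  have hg1 : ∀ x y : ZMod 3, y = 2 → sqG 1 1 x (y - x) = -(if x = 1 then 1 else 0) := by decide
  have hg2 : ∀ x y : ZMod 3, y = 1 → sqG 2 2 x (y - x) = -(if x = 2 then 1 else 0) := by decide
  rcases mod_three_of_mul_mod_three h with ⟨h1, h2⟩ | ⟨h1, h2⟩
  · obtain ⟨m, rfl⟩ : ∃ m, D = 3 * m + 2 := ⟨D / 3, by omega⟩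
    have hs : ∑ e ∈ Finset.Ico 1 (3 * m + 2), sqG d d e ((3 * m + 2 - e : ℕ) : ZMod 3) =
        ∑ e ∈ Finset.Ico 1 (3 * m + 2), -(if e % 3 = 1 then 1 else 0 : ℤ) := by
      refine Finset.sum_congr rfl fun e he => ?_
      rw [Nat.cast_sub (Finset.mem_Ico.1 he).2.le, (natCast_zmod_three_eq_one_iff d).2 h1,
        hg1 _ _ ((natCast_zmod_three_eq_two_iff _).2 h2)]
      simp only [natCast_zmod_three_eq_one_iff]
    simp only [hs, Finset.sum_neg_distrib, sum_Ico_mod_three_eq_one]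
    simp [chi, h2]
    ring
  · obtain ⟨m, rfl⟩ : ∃ m, D = 3 * m + 1 := ⟨D / 3, by omega⟩
    have hs : ∑ e ∈ Finset.Ico 1 (3 * m + 1), sqG d d e ((3 * m + 1 - e : ℕ) : ZMod 3) =
        ∑ e ∈ Finset.Ico 1 (3 * m + 1), -(if e % 3 = 2 then 1 else 0 : ℤ) := by
      refine Finset.sum_congr rfl fun e he => ?_
      rw [Nat.cast_sub (Finset.mem_Ico.1 he).2.le, (natCast_zmod_three_eq_two_iff d).2 h1,
        hg2 _ _ ((natCast_zmod_three_eq_one_iff _).2 h2)]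
      simp only [natCast_zmod_three_eq_two_iff]
    simp only [hs, Finset.sum_neg_distrib, sum_Ico_mod_three_eq_two]
    simp [chi, h2]

/-- In `liouville` the diagonal `e = e'` contributes nothing, and the diagonal `d = d'` contributes
`(D - chi D) / 3` for each factorization `d * D = 3 * k + 2`. The terms `chi D` add up to zero. -/
theorem three_mul_sum_divSum_mul (k : ℕ) :
    3 * ∑ p ∈ Finset.HasAntidiagonal.antidiagonal k, divSum (3 * p.1 + 1) * divSum (3 * p.2 + 1) =
      ∑ d ∈ (3 * k + 2).divisors, (d : ℤ) := by
  have hE : ∑ v ∈ quads (3 * k + 2), sqE v.1 v.2.1 v.2.2.1 v.2.2.2 = 0 :=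
    sum_quads_eq_zero _ (fun d d' e e' => sqE d d' e e') fun d d' e e' => by
      have : ∀ a b c d : ZMod 3, sqE c b a d = -sqE a b c d := by decide
      exact this _ _ _ _
  have hE' := sum_quads_swap (3 * k + 2) fun d d' e e' => sqE d d' e e'
  have hL := liouville (3 * k + 2) (fun d d' e e' => sqF d d' e e')
    (fun d d' e e' => sqG d d' e e')
    (fun d d' e e' => by
      have : ∀ a b c d : ZMod 3, sqF a b c d = sqF b a d c := by decide
      exact this _ _ _ _)
    (fun d d' e e' => by
      have : ∀ a b c d : ZMod 3, sqG a b c d = sqG b a d c := by decide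
      exact this _ _ _ _)
    (fun x y z w => by
      have : ∀ a b c d : ZMod 3, sqG (a + b) b c d = sqF a b c (c + d) := by decide
      push_cast
      exact this _ _ _ _)
  simp only [sqF_sub_sqG, Finset.sum_add_distrib] at hL
  rw [← hE', hE, add_zero, add_zero] at hL
  have hM := sum_quads_mul (3 * k + 2)
    (fun d e => if (d : ZMod 3) * e = 1 then chiZ d else 0)
    (fun d e => if (d : ZMod 3) * e = 1 then chiZ d else 0)
  simp only [← chi_eq_chiZ] at hM hL
  simp only [sum_divisorsAntidiagonal_ite, natCast_zmod_three_eq_one_iff] at hM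
  have hA := sum_antidiagonal_three_mul k 1 1
    (fun u v => (if u % 3 = 1 then ∑ d ∈ u.divisors, chi d else 0) *
      if v % 3 = 1 then ∑ d ∈ v.divisors, chi d else 0)
    (fun u v h => by
      by_cases hu : u % 3 = 1
      · rw [if_neg (fun hv => h ⟨hu, hv⟩), mul_zero]
      · rw [if_neg hu, zero_mul])
  rw [← hM, hL] at hA
  have h1 : ∀ i, (3 * i + 1) % 3 = 1 := fun i => by omega
  simp only [h1, if_true] at hA
  change ∑ p ∈ Finset.HasAntidiagonal.antidiagonal k,
    divSum (3 * p.1 + 1) * divSum (3 * p.2 + 1) = _ at hA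
  rw [hA]
  have hF : ∑ v ∈ quads (3 * k + 2), (if v.2.2.1 = v.2.2.2 then
      sqF v.1 v.2.1 v.2.2.1 v.2.2.2 else 0) = 0 := by
    refine Finset.sum_eq_zero fun v _ => ?_
    have : ∀ a b c : ZMod 3, sqF a b c c = 0 := by decide
    split_ifs with h
    · rw [h, this]
    · rfl
  have hG := sum_quads_diag (3 * k + 2) (fun d e e' => sqG d d e e')
  have hG' : ∑ v ∈ quads (3 * k + 2), (if v.1 = v.2.1 then
      sqG v.1 v.2.1 v.2.2.1 v.2.2.2 else 0) = ∑ v ∈ quads (3 * k + 2), (if v.1 = v.2.1 then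
      sqG v.1 v.1 v.2.2.1 v.2.2.2 else 0) := by
    refine Finset.sum_congr rfl fun v _ => ?_
    split_ifs with h
    · rw [← h]
    · rfl
  rw [hF, hG', hG, zero_sub, mul_neg, Finset.mul_sum, ← Finset.sum_neg_distrib]
  have hin : ∀ p ∈ (3 * k + 2).divisorsAntidiagonal,
      -(3 * ∑ e ∈ Finset.Ico 1 p.2, sqG p.1 p.1 e ((p.2 - e : ℕ) : ZMod 3)) = p.2 - chi p.2 :=
    fun p hp => sum_sqG (by rw [(Nat.mem_divisorsAntidiagonal.1 hp).1]; omega)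
  rw [Finset.sum_congr rfl hin, Finset.sum_sub_distrib, sum_chi_divisors_eq_zero (by omega),
    sub_zero, ← Nat.map_div_left_divisors, Finset.sum_map]
  rfl

/-! ### The threefold convolution. -/

/-- The coefficient of `d` in the function to which Liouville's formula is applied for the cube. -/
def cubF (a b c d : ZMod 3) : ℤ :=
  if (a = 0 ∧ b ≠ 0 ∧ d = 0) ∨ (a + b = 0 ∧ a ≠ 0 ∧ c = d) then chiZ c else 0

/-- The coefficient of `d` in the companion of the function given by `cubF`. -/
def cubG (a b c d : ZMod 3) : ℤ :=
  if (a = 0 ∧ b ≠ 0 ∧ d = 0) ∨ (a = b ∧ a ≠ 0 ∧ c + d = 0) then chiZ c else 0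

/-- The part of the difference of the two functions that does not contribute to the sum. -/
def cubE (a b c d : ZMod 3) : ℤ := if a * c = 2 ∧ b * d = 1 then chiZ c else 0

theorem cubF_sub_cubG : ∀ a b c d : ZMod 3, cubF b a d c - cubG b a d c =
    (if a * c = 1 then chiZ a else 0) * (if b * d = 2 then 1 else 0) + cubE a b c d := by
  decide

/-- If `3 ∣ e` everything vanishes. Otherwise `3 ∣ D`, and each of the `2 * D / 3` values `d` prime
to 3 contributes `chi e * D` before the factor 3. -/
theorem sum_cubF {e D n : ℕ} (h : e * D = 3 * n) :
    ∑ d ∈ Finset.Ico 1 D, (cubF d ((D - d : ℕ) : ZMod 3) e e * d +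
      cubF ((D - d : ℕ) : ZMod 3) d e e * ((D - d : ℕ) : ℤ)) * 3 = 2 * (chi e * D ^ 2) := by
  rw [chi_eq_chiZ]
  have hcases : (e : ZMod 3) = 0 ∨ 3 ∣ D := by
    have h1 : 3 ∣ e * D := ⟨n, h⟩
    rcases (Nat.Prime.dvd_mul Nat.prime_three).1 h1 with h2 | h2
    · exact Or.inl ((ZMod.natCast_eq_zero_iff e 3).2 h2)
    · exact Or.inr h2
  rcases hcases with he | ⟨m, rfl⟩
  · have h0 : ∀ a b : ZMod 3, cubF a b 0 0 = 0 := by decide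
    have h1 : chiZ 0 = 0 := rfl
    simp [he, h0, h1]
  · have key : ∀ x y z : ZMod 3, y = 0 → cubF x (y - x) z z = (if x = 0 then 0 else 1) * chiZ z ∧
        cubF (y - x) x z z = (if x = 0 then 0 else 1) * chiZ z := by decide
    have hs : ∀ d ∈ Finset.Ico 1 (3 * m), (cubF d ((3 * m - d : ℕ) : ZMod 3) e e * d +
        cubF ((3 * m - d : ℕ) : ZMod 3) d e e * ((3 * m - d : ℕ) : ℤ)) * 3 =
        (if d % 3 = 0 then 0 else 1) * (9 * m * chiZ e) := by
      intro d hd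
      have hd' := (Finset.mem_Ico.1 hd).2.le
      have h0 : ((3 * m : ℕ) : ZMod 3) = 0 := (ZMod.natCast_eq_zero_iff _ 3).2 ⟨m, rfl⟩
      rw [Nat.cast_sub hd', Nat.cast_sub hd', (key _ _ _ h0).1, (key _ _ _ h0).2]
      simp only [ZMod.natCast_eq_zero_iff, Nat.dvd_iff_mod_eq_zero]
      push_cast
      ring
    rw [Finset.sum_congr rfl hs, ← Finset.sum_mul, sum_Ico_mod_three_ne_zero]
    push_cast
    ring

/-- A term with `3 ∣ e` has `chi e = 0`; in the others 3 divides the cofactor, whose square yields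
the 9. -/
theorem sum_chi_mul_sq_three_mul {n : ℕ} (hn : 0 < n) :
    ∑ p ∈ (3 * n).divisorsAntidiagonal, chi p.1 * (p.2 : ℤ) ^ 2 =
      9 * ∑ p ∈ n.divisorsAntidiagonal, chi p.1 * (p.2 : ℤ) ^ 2 := by
  rw [Finset.mul_sum]
  symm
  refine Finset.sum_of_injOn (fun p => (p.1, 3 * p.2)) ?_ ?_ ?_ ?_
  · rintro ⟨i, j⟩ - ⟨i', j'⟩ - h
    simp only [Prod.mk.injEq] at h ⊢
    omega
  · rintro ⟨e, D⟩ h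
    simp only [Finset.mem_coe, Nat.mem_divisorsAntidiagonal] at h ⊢
    refine ⟨?_, by omega⟩
    rw [← h.1]
    ring
  · rintro ⟨e, D⟩ h h'
    rw [Nat.mem_divisorsAntidiagonal] at h
    simp only at h
    have h3 : 3 ∣ e := by
      rcases (Nat.Prime.dvd_mul Nat.prime_three).1 ⟨n, h.1⟩ with h2 | ⟨m, rfl⟩
      · exact h2
      · refine absurd ⟨(e, m), ?_, rfl⟩ h'
        simp only [Finset.mem_coe, Nat.mem_divisorsAntidiagonal]
        refine ⟨?_, hn.ne'⟩
        have := h.1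
        rw [mul_left_comm] at this
        omega
    have : chi e = 0 := by
      simp only [chi]
      rw [if_neg (by omega), if_neg (by omega)]
    simp [this]
  · rintro ⟨e, D⟩ -
    push_cast
    ring

theorem sum_quads_cube {n : ℕ} (hn : 0 < n) :
    ∑ v ∈ quads (3 * n), (if (v.1 : ZMod 3) * v.2.2.1 = 1 then chi v.1 else 0) *
      (if (v.2.1 : ZMod 3) * v.2.2.2 = 2 then (v.2.1 : ℤ) else 0) =
      3 * ∑ p ∈ n.divisorsAntidiagonal, chi p.1 * (p.2 : ℤ) ^ 2 := by
  have hE : ∑ v ∈ quads (3 * n), cubE v.1 v.2.1 v.2.2.1 v.2.2.2 * v.2.1 = 0 :=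
    sum_quads_eq_zero _ (fun d d' e e' => cubE d d' e e' * d') fun d d' e e' => by
      have : ∀ a b c d : ZMod 3, cubE c b a d = -cubE a b c d := by decide
      simp only [this d, neg_mul]
  have hL := liouville (3 * n) (fun d d' e e' => cubF d d' e e' * d + cubF d' d e' e * d')
    (fun d d' e e' => cubG d d' e e' * d + cubG d' d e' e * d')
    (fun d d' e e' => by ring) (fun d d' e e' => by ring)
    (fun x y z w => by
      -- The hypothesis `hfg` is linear in `x` and `y`: `h1` compares the coefficients of `x`, `h2`
      -- those of `y`.
      have h1 : ∀ a b c d : ZMod 3, cubG (a + b) b c d = cubF a b c (c + d) := by decide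
      have h2 : ∀ a b c d : ZMod 3, cubG (a + b) b c d + cubG b (a + b) d c =
        cubF b a (c + d) c := by decide
      have h3 := h1 x y z w
      have h4 := h2 x y z w
      push_cast
      rw [← h3, ← h4]
      ring)
  have hS := sum_quads_swap (3 * n) fun d d' e e' => (cubF d d' e e' - cubG d d' e e') * d
  have hW : ∑ v ∈ quads (3 * n),
      (cubF v.2.1 v.1 v.2.2.2 v.2.2.1 - cubG v.2.1 v.1 v.2.2.2 v.2.2.1) * v.2.1 =
      ∑ v ∈ quads (3 * n), (if (v.1 : ZMod 3) * v.2.2.1 = 1 then chi v.1 else 0) *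
        (if (v.2.1 : ZMod 3) * v.2.2.2 = 2 then (v.2.1 : ℤ) else 0) := by
    refine Eq.trans ?_ ((congrArg _ hE).trans (add_zero _))
    rw [← Finset.sum_add_distrib]
    refine Finset.sum_congr rfl fun v _ => ?_
    rw [cubF_sub_cubG, chi_eq_chiZ, add_mul, mul_assoc, ite_mul _ (1 : ℤ), one_mul, zero_mul]
  have hsum : ∑ v ∈ quads (3 * n), (cubF v.1 v.2.1 v.2.2.1 v.2.2.2 * v.1 +
      cubF v.2.1 v.1 v.2.2.2 v.2.2.1 * v.2.1 - (cubG v.1 v.2.1 v.2.2.1 v.2.2.2 * v.1 +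
      cubG v.2.1 v.1 v.2.2.2 v.2.2.1 * v.2.1)) =
      2 * ∑ v ∈ quads (3 * n),
        (cubF v.2.1 v.1 v.2.2.2 v.2.2.1 - cubG v.2.1 v.1 v.2.2.2 v.2.2.1) * v.2.1 := by
    rw [two_mul]
    nth_rewrite 1 [← hS]
    rw [← Finset.sum_add_distrib]
    exact Finset.sum_congr rfl fun v _ => by ring
  rw [hsum, hW] at hL
  -- Here the roles are reversed: the diagonal `d = d'` cancels and the diagonal `e = e'` carries
  -- the sum.
  have hG : ∑ v ∈ quads (3 * n), (if v.1 = v.2.1 then cubG v.1 v.2.1 v.2.2.1 v.2.2.2 * v.1 +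
      cubG v.2.1 v.1 v.2.2.2 v.2.2.1 * v.2.1 else 0) = 0 := by
    refine Finset.sum_eq_zero fun v _ => ?_
    have : ∀ a c d : ZMod 3, cubG a a c d + cubG a a d c = 0 := by decide
    split_ifs with h
    · rw [← h, ← add_mul, this, zero_mul]
    · rfl
  have hF := sum_quads_diag' (3 * n)
    (fun e d d' => cubF d d' e e * d + cubF d' d e e * d')
  have hF' : ∑ v ∈ quads (3 * n), (if v.2.2.1 = v.2.2.2 then
      cubF v.1 v.2.1 v.2.2.1 v.2.2.2 * v.1 + cubF v.2.1 v.1 v.2.2.2 v.2.2.1 * v.2.1 else 0) =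
      ∑ v ∈ quads (3 * n), (if v.2.2.1 = v.2.2.2 then
      cubF v.1 v.2.1 v.2.2.1 v.2.2.1 * v.1 + cubF v.2.1 v.1 v.2.2.1 v.2.2.1 * v.2.1 else 0) := by
    refine Finset.sum_congr rfl fun v _ => ?_
    split_ifs with h
    · rw [← h]
    · rfl
  rw [hG, hF', hF, sub_zero] at hL
  have hD : (∑ p ∈ (3 * n).divisorsAntidiagonal, ∑ d ∈ Finset.Ico 1 p.2,
      (cubF d ((p.2 - d : ℕ) : ZMod 3) p.1 p.1 * d +
        cubF ((p.2 - d : ℕ) : ZMod 3) d p.1 p.1 * ((p.2 - d : ℕ) : ℤ))) * 3 =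
      2 * ∑ p ∈ (3 * n).divisorsAntidiagonal, chi p.1 * (p.2 : ℤ) ^ 2 := by
    simp only [Finset.sum_mul, Finset.mul_sum]
    exact Finset.sum_congr rfl fun p hp => sum_cubF (Nat.mem_divisorsAntidiagonal.1 hp).1
  rw [← hL, sum_chi_mul_sq_three_mul hn] at hD
  omega

/-- The number of triples of `3`-cores, as a divisor sum. -/
theorem coe_B_three_eq (n : ℕ) :
    (B 3 n : ℤ) = ∑ p ∈ (n + 1).divisorsAntidiagonal, chi p.1 * (p.2 : ℤ) ^ 2 := by
  have hM := sum_quads_mul (3 * (n + 1))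
    (fun d e => if (d : ZMod 3) * e = 1 then chi d else 0)
    (fun d e => if (d : ZMod 3) * e = 2 then (d : ℤ) else 0)
  rw [sum_quads_cube (by omega : 0 < n + 1)] at hM
  simp only [sum_divisorsAntidiagonal_ite, natCast_zmod_three_eq_one_iff,
    natCast_zmod_three_eq_two_iff] at hM
  have hA := sum_antidiagonal_three_mul n 1 2
    (fun u v => (if u % 3 = 1 then ∑ d ∈ u.divisors, chi d else 0) *
      if v % 3 = 2 then ∑ d ∈ v.divisors, (d : ℤ) else 0)
    (fun u v h => by
      by_cases hu : u % 3 = 1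
      · rw [if_neg (fun hv => h ⟨hu, hv⟩), mul_zero]
      · rw [if_neg hu, zero_mul])
  have h1 : ∀ i, (3 * i + 1) % 3 = 1 := fun i => by omega
  have h2 : ∀ i, (3 * i + 2) % 3 = 2 := fun i => by omega
  have e : 3 * n + (1 + 2) = 3 * (n + 1) := by ring
  rw [e, ← hM] at hA
  simp only [h1, h2, if_true, ← three_mul_sum_divSum_mul] at hA
  -- The factor 3 turns the inner convolution into the divisor sum of `3 * p.2 + 2`; the two
  -- arguments then add up to `3 * (n + 1)`.
  have hB : 3 * (B 3 n : ℤ) = ∑ p ∈ Finset.HasAntidiagonal.antidiagonal n,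
      (∑ d ∈ (3 * p.1 + 1).divisors, chi d) * (3 * ∑ q ∈ Finset.HasAntidiagonal.antidiagonal p.2,
        divSum (3 * q.1 + 1) * divSum (3 * q.2 + 1)) := by
    rw [coe_B_three, Finset.mul_sum]
    exact Finset.sum_congr rfl fun p _ => by rw [divSum]; ring
  rw [hA] at hB
  omega

/-! ### The congruence modulo 120. -/

/-- Odd squares are 1 modulo 8, and squares of units are 1 modulo 3. Modulo 5, `D` is plus or minus
the inverse of `e`, and `e ^ 4 = 1`. -/
theorem dvd_sq_sub_sq {e D : ℕ} (h2 : (e * D) % 2 = 1) (h3 : (e * D) % 3 = 2)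
    (h5 : (e * D) % 5 = 1 ∨ (e * D) % 5 = 4) : (120 : ℤ) ∣ (D : ℤ) ^ 2 - (e : ℤ) ^ 2 := by
  have h8 : (8 : ℤ) ∣ (D : ℤ) ^ 2 - (e : ℤ) ^ 2 := by
    have ho := Nat.odd_mul.1 (Nat.odd_iff.2 h2)
    have a1 : (8 : ℤ) ∣ (D : ℤ) ^ 2 - 1 := Int.eight_dvd_sq_sub_one_of_odd (by exact_mod_cast ho.2)
    have a2 : (8 : ℤ) ∣ (e : ℤ) ^ 2 - 1 := Int.eight_dvd_sq_sub_one_of_odd (by exact_mod_cast ho.1)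
    have := dvd_sub a1 a2
    simpa using this
  have h3' : (3 : ℤ) ∣ (D : ℤ) ^ 2 - (e : ℤ) ^ 2 := by
    have key : ∀ x y : ZMod 3, x * y = 2 → y ^ 2 - x ^ 2 = 0 := by decide
    have := key e D (by
      have := (natCast_zmod_three_eq_two_iff (e * D)).2 h3
      exact_mod_cast this)
    exact (ZMod.intCast_zmod_eq_zero_iff_dvd _ 3).1 (by exact_mod_cast this)
  have h5' : (5 : ℤ) ∣ (D : ℤ) ^ 2 - (e : ℤ) ^ 2 := by
    have key : ∀ x y : ZMod 5, x * y = 1 ∨ x * y = 4 → y ^ 2 - x ^ 2 = 0 := by decide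
    have := key e D (by
      rcases h5 with h | h
      · left
        have : ((e * D : ℕ) : ZMod 5) = (1 : ℕ) := (ZMod.natCast_eq_natCast_iff' _ _ _).2 h
        exact_mod_cast this
      · right
        have : ((e * D : ℕ) : ZMod 5) = (4 : ℕ) := (ZMod.natCast_eq_natCast_iff' _ _ _).2 h
        exact_mod_cast this)
    exact (ZMod.intCast_zmod_eq_zero_iff_dvd _ 5).1 (by exact_mod_cast this)
  omega

theorem dvd_B_three {n : ℕ} (h2 : (n + 1) % 2 = 1) (h3 : (n + 1) % 3 = 2)
    (h5 : (n + 1) % 5 = 1 ∨ (n + 1) % 5 = 4) : B 3 n ≡ 0 [MOD 120] := by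
  rw [Nat.modEq_zero_iff_dvd]
  have hZ : ((120 : ℕ) : ℤ) ∣ (B 3 n : ℤ) := by
    rw [coe_B_three_eq]
    -- Since the product is 2 modulo 3, `p.1` is 2 modulo 3 exactly when `p.2` is 1. Swapping the
    -- factors in the second term leaves differences of squares.
    have hp : ∀ p ∈ (n + 1).divisorsAntidiagonal, chi p.1 * (p.2 : ℤ) ^ 2 =
        (if p.1 % 3 = 1 then (p.2 : ℤ) ^ 2 else 0) - if p.2 % 3 = 1 then (p.2 : ℤ) ^ 2 else 0 := by
      intro p hp
      have h := (Nat.mem_divisorsAntidiagonal.1 hp).1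
      rcases mod_three_of_mul_mod_three (h ▸ h3) with h | h <;> simp [chi, h]
    have hswap : ∑ p ∈ (n + 1).divisorsAntidiagonal,
        (if p.2 % 3 = 1 then (p.2 : ℤ) ^ 2 else 0) =
        ∑ p ∈ (n + 1).divisorsAntidiagonal, if p.1 % 3 = 1 then (p.1 : ℤ) ^ 2 else 0 := by
      conv_lhs => rw [← Nat.map_swap_divisorsAntidiagonal, Finset.sum_map]
      rfl
    rw [Finset.sum_congr rfl hp, Finset.sum_sub_distrib, hswap, ← Finset.sum_sub_distrib]
    refine Finset.dvd_sum fun p hp => ?_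
    have h := (Nat.mem_divisorsAntidiagonal.1 hp).1
    split_ifs
    · exact dvd_sq_sub_sq (h ▸ h2) (h ▸ h3) (h ▸ h5)
    · simp
  exact_mod_cast hZ

theorem mainTheorem7 (n : ℕ) :
    B 3 (30 * n + 10) ≡ 0 [MOD 120] ∧ B 3 (30 * n + 28) ≡ 0 [MOD 120] :=
  ⟨dvd_B_three (by omega) (by omega) (by omega), dvd_B_three (by omega) (by omega) (by omega)⟩
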